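/- Let $\mathcal H_s,\mathcal H_b$ be complex Hilbert spaces, let $H$ be a self-adjoint (possibly unbounded) operator on the Hilbert space tensor product $\mathcal H_s\otimes\mathcal H_b$, and let $\rho_0$ be any density operator on $\mathcal H_s\otimes\mathcal H_b$ (a positive trace-class operator of trace $1$; factorized or correlated). Then the strongly continuous one-parameter unitary group $(e^{-iHt})_{t\in\mathbb R}$ with generator $-iH$ exists; the map $t\mapsto e^{-iHt}\rho_0e^{iHt}$ is continuous in trace norm; the partial trace $\mathrm{Tr}_b$ from the trace-class operators on $\mathcal H_s\otimes\mathcal H_b$ to those on $\mathcal H_s$ is continuous for the trace norms; and the reduced state $$\sigma(t)=\mathrm{Tr}_b\bigl[e^{-iHt}\rho_0e^{iHt}\bigr]$$ is continuous in trace norm, with operator norm $\|\sigma(t)\|_{\mathrm{op}}\le 1$ for all $t\ge 0$. Moreover, for every $z$ in the open upper half-plane $\mathbb H_+=\{z\in\mathbb C:\operatorname{Im}z>0\}$ the Laplace integral $$\tilde\sigma(z)=\int_0^\infty e^{izt}\,\sigma(t)\,dt$$ converges absolutely in trace norm (as a Bochner integral), the function $\tilde\sigma$ is analytic in $\mathbb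 H_+$ with values in the Banach space of trace-class operators on $\mathcal H_s$, and $\|\tilde\sigma(z)\|_{\mathrm{op}}\le 1/\operatorname{Im}(z)$ for all $z\in\mathbb H_+$. -/

import Mathlib

open scoped ENNReal InnerProductSpace

section TraceClassOperators

open scoped InnerProduct

set_option linter.unusedSectionVars false

variable {K G L : Type*}
  [NormedAddCommGroup K] [InnerProductSpace ℂ K] [CompleteSpace K]
  [NormedAddCommGroup G] [InnerProductSpace ℂ G] [CompleteSpace G]
  [NormedAddCommGroup L] [InnerProductSpace ℂ L] [CompleteSpace L]

/-- The vectors of an arbitrarily chosen orthonormal basis of a Hilbert space. -/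
noncomputable def onbSet (K : Type*) [NormedAddCommGroup K] [InnerProductSpace ℂ K]
    [CompleteSpace K] : Set K :=
  (exists_hilbertBasis ℂ K).choose

/-- An arbitrarily chosen orthonormal basis of a Hilbert space. -/
noncomputable def onb (K : Type*) [NormedAddCommGroup K] [InnerProductSpace ℂ K]
    [CompleteSpace K] : HilbertBasis (onbSet K) ℂ K :=
  (exists_hilbertBasis ℂ K).choose_spec.choose

/-- The trace in `[0, ∞]` of a positive operator. -/
noncomputable def posTrace (A : K →L[ℂ] K) : ℝ≥0∞ :=
  ∑' i, ENNReal.ofReal (RCLike.re ⟪onb K i, A (onb K i)⟫_ℂ)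

/-- The trace norm `Tr |A|`, `|A| = √(A† A)`, of a bounded operator, with values in `[0, ∞]`. -/
noncomputable def traceNorm (A : K →L[ℂ] K) : ℝ≥0∞ := posTrace (CFC.abs A)

theorem exists_contraction_of_norm_le (P A : K →L[ℂ] K) (h : ∀ x, ‖A x‖ ≤ ‖P x‖) :
    ∃ W : K →L[ℂ] K, ‖W‖ ≤ 1 ∧ A = W ∘L P := by
  let R : Submodule ℂ K := (LinearMap.range (P : K →ₗ[ℂ] K)).topologicalClosure
  have hR : ∀ x, P x ∈ R := fun x => Submodule.le_topologicalClosure _ ⟨x, rfl⟩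
  let e : K →ₗ[ℂ] R := (P : K →ₗ[ℂ] K).codRestrict R hR
  have he : DenseRange e := by
    intro y
    rw [closure_subtype]
    have : (Subtype.val '' Set.range e : Set K) = LinearMap.range (P : K →ₗ[ℂ] K) := by
      ext z; constructor
      · rintro ⟨_, ⟨x, rfl⟩, rfl⟩; exact ⟨x, rfl⟩
      · rintro ⟨x, rfl⟩; exact ⟨_, ⟨x, rfl⟩, rfl⟩
    rw [this]
    exact y.2
  have hb : ∀ x, ‖(A : K →ₗ[ℂ] K) x‖ ≤ 1 * ‖e x‖ := fun x => by
    rw [one_mul]; exact h x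
  have : CompleteSpace R := (Submodule.isClosed_topologicalClosure _).completeSpace_coe
  refine ⟨(LinearMap.extendOfNorm (A : K →ₗ[ℂ] K) e) ∘L R.orthogonalProjectionOnto, ?_, ?_⟩
  · refine (ContinuousLinearMap.opNorm_comp_le _ _).trans ?_
    exact mul_le_one₀ (LinearMap.opNorm_extendOfNorm_le he zero_le_one hb) (norm_nonneg _)
      R.orthogonalProjectionOnto_norm_le
  · ext x
    have h1 : R.orthogonalProjectionOnto (P x) = e x :=
      R.orthogonalProjectionOnto_mem_subspace_eq_self (e x)
    simp only [ContinuousLinearMap.comp_apply]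
    rw [h1, LinearMap.extendOfNorm_eq he ⟨1, hb⟩]
    rfl

theorem norm_abs_apply (A : K →L[ℂ] K) (x : K) : ‖CFC.abs A x‖ = ‖A x‖ := by
  have h0 : (CFC.abs A)† = CFC.abs A := (CFC.abs_nonneg A).isSelfAdjoint
  have h1 : ⟪CFC.abs A x, CFC.abs A x⟫_ℂ = ⟪A x, A x⟫_ℂ := by
    rw [← ContinuousLinearMap.adjoint_inner_right, h0, ← ContinuousLinearMap.adjoint_inner_right]
    have := congrArg (fun T : K →L[ℂ] K => T x) (CFC.abs_mul_abs A)
    exact congrArg _ this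
  rw [inner_self_eq_norm_sq_to_K, inner_self_eq_norm_sq_to_K] at h1
  have h2 : ‖CFC.abs A x‖ ^ 2 = ‖A x‖ ^ 2 := by exact_mod_cast h1
  exact (sq_eq_sq₀ (norm_nonneg _) (norm_nonneg _)).1 h2

theorem HilbertBasis.tsum_enorm_inner_sq {ι : Type*} (g : HilbertBasis ι ℂ K) (x : K) :
    ∑' k, ‖⟪g k, x⟫_ℂ‖ₑ ^ 2 = ‖x‖ₑ ^ 2 := by
  have h := (g.hasSum_inner_mul_inner x x)
  have h' : HasSum (fun k => ‖⟪g k, x⟫_ℂ‖ ^ 2) (‖x‖ ^ 2) := by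
    rw [inner_self_eq_norm_sq_to_K] at h
    have h2 := Complex.hasSum_re h
    convert h2 using 1
    · ext k
      rw [← inner_conj_symm x (g k), RCLike.conj_mul]
      norm_cast
    · norm_cast
  have h3 := ENNReal.ofReal_tsum_of_nonneg (fun k => by positivity) h'.summable
  rw [h'.tsum_eq] at h3
  simp only [← ofReal_norm, ← ENNReal.ofReal_pow (norm_nonneg _)]
  exact h3.symm

theorem Orthonormal.tsum_enorm_inner_sq_le {ι : Type*} {e : ι → K} (he : Orthonormal ℂ e) (x : K) :
    ∑' k, ‖⟪x, e k⟫_ℂ‖ₑ ^ 2 ≤ ‖x‖ₑ ^ 2 := by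
  rw [ENNReal.tsum_eq_iSup_sum]
  refine iSup_le fun s => ?_
  have := ENNReal.ofReal_le_ofReal (he.sum_inner_products_le (s := s) x)
  rw [ENNReal.ofReal_sum_of_nonneg (fun _ _ => by positivity)] at this
  simp only [ENNReal.ofReal_pow (norm_nonneg _), ofReal_norm] at this
  simpa only [← ofReal_norm, norm_inner_symm x] using this

theorem tsum_enorm_sq_comp_le {ι κ : Type*} (g : HilbertBasis ι ℂ K) (S : K →L[ℂ] K) (hS : S† = S)
    (C : G →L[ℂ] K) {e : κ → G} (he : Orthonormal ℂ e) :
    ∑' i, ‖S (C (e i))‖ₑ ^ 2 ≤ ‖C‖ₑ ^ 2 * ∑' k, ‖S (g k)‖ₑ ^ 2 := by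
  simp only [← g.tsum_enorm_inner_sq (S (C _))]
  rw [ENNReal.tsum_comm, ← ENNReal.tsum_mul_left]
  refine ENNReal.tsum_le_tsum fun k => ?_
  have h1 : ∀ i, ⟪g k, S (C (e i))⟫_ℂ = ⟪(C†) (S (g k)), e i⟫_ℂ := fun i => by
    rw [ContinuousLinearMap.adjoint_inner_left, ← ContinuousLinearMap.adjoint_inner_left, hS]
  simp only [h1]
  refine (he.tsum_enorm_inner_sq_le _).trans ?_
  rw [← mul_pow]
  gcongr
  refine ((C†).le_opENorm _).trans_eq ?_
  simp only [enorm_eq_nnnorm, LinearIsometryEquiv.nnnorm_map]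

/-- The fundamental estimate behind the properties of the trace norm. -/
theorem tsum_enorm_inner_le_of_basis {ι κ : Type*} (g : HilbertBasis ι ℂ K) (A : K →L[ℂ] K)
    (B : K →L[ℂ] L) (C : G →L[ℂ] K) {e : κ → G} {f : κ → L} (he : Orthonormal ℂ e)
    (hf : Orthonormal ℂ f) :
    ∑' i, ‖⟪f i, B (A (C (e i)))⟫_ℂ‖ₑ ≤
      ‖B‖ₑ * ‖C‖ₑ * ∑' k, ENNReal.ofReal (RCLike.re ⟪g k, CFC.abs A (g k)⟫_ℂ) := by
  obtain ⟨W, hW, hAW⟩ := exists_contraction_of_norm_le (CFC.abs A) A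
    fun x => (norm_abs_apply A x).ge
  set S : K →L[ℂ] K := CFC.sqrt (CFC.abs A) with hSdef
  have hS : S† = S := (CFC.sqrt_nonneg (CFC.abs A)).isSelfAdjoint
  have hSS : S ∘L S = CFC.abs A := CFC.sqrt_mul_sqrt_self _ (CFC.abs_nonneg A)
  have hM : ∀ k, ENNReal.ofReal (RCLike.re ⟪g k, CFC.abs A (g k)⟫_ℂ) = ‖S (g k)‖ₑ ^ 2 := by
    intro k
    rw [← hSS, ContinuousLinearMap.comp_apply, ← ContinuousLinearMap.adjoint_inner_left, hS,
      inner_self_eq_norm_sq, ENNReal.ofReal_pow (norm_nonneg _), ofReal_norm]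
  simp only [hM]
  set M := ∑' k, ‖S (g k)‖ₑ ^ 2
  have hle : ∀ i, ‖⟪f i, B (A (C (e i)))⟫_ℂ‖ₑ ≤
      ‖S ((W† ∘L B†) (f i))‖ₑ * ‖S (C (e i))‖ₑ := by
    intro i
    have : ⟪f i, B (A (C (e i)))⟫_ℂ = ⟪S ((W† ∘L B†) (f i)), S (C (e i))⟫_ℂ := by
      conv_lhs => rw [hAW, ← hSS]
      simp only [ContinuousLinearMap.comp_apply]
      rw [← ContinuousLinearMap.adjoint_inner_left B, ← ContinuousLinearMap.adjoint_inner_left W,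
        ← ContinuousLinearMap.adjoint_inner_left S, hS]
    rw [this]
    simp only [← ofReal_norm, ← ENNReal.ofReal_mul (norm_nonneg _)]
    exact ENNReal.ofReal_le_ofReal (norm_inner_le_norm _ _)
  have h1 := tsum_enorm_sq_comp_le g S hS (W† ∘L B†) hf
  have h2 := tsum_enorm_sq_comp_le g S hS C he
  have hWB : ‖W† ∘L B†‖ₑ ≤ ‖B‖ₑ := by
    simp only [← ofReal_norm]
    refine ENNReal.ofReal_le_ofReal ((ContinuousLinearMap.opNorm_comp_le _ _).trans ?_)
    rw [LinearIsometryEquiv.norm_map, LinearIsometryEquiv.norm_map]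
    exact mul_le_of_le_one_left (norm_nonneg _) hW
  rw [ENNReal.tsum_eq_iSup_sum]
  refine iSup_le fun s => (Finset.sum_le_sum fun i _ => hle i).trans ?_
  refine (ENNReal.inner_le_Lp_mul_Lq s _ _ Real.HolderConjugate.two_two).trans ?_
  simp only [ENNReal.rpow_ofNat]
  have key : ∀ (x c : ℝ≥0∞), x ≤ c ^ 2 * M → x ^ (1 / (2 : ℝ)) ≤ c * M ^ (1 / (2 : ℝ)) := by
    intro x c hx
    refine (ENNReal.rpow_le_rpow hx (by norm_num)).trans_eq ?_
    rw [ENNReal.mul_rpow_of_nonneg _ _ (by norm_num), ← ENNReal.rpow_natCast, ← ENNReal.rpow_mul]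
    norm_num
  refine (mul_le_mul' (key _ ‖B‖ₑ (((ENNReal.sum_le_tsum s).trans h1).trans (by gcongr)))
    (key _ ‖C‖ₑ ((ENNReal.sum_le_tsum s).trans h2))).trans_eq ?_
  have hMM : M ^ (1 / (2 : ℝ)) * M ^ (1 / (2 : ℝ)) = M := by
    rw [← ENNReal.rpow_add_of_nonneg _ _ (by norm_num) (by norm_num)]
    norm_num
  rw [mul_mul_mul_comm, hMM]


theorem exists_contraction_abs (A : K →L[ℂ] K) :
    ∃ W : K →L[ℂ] K, ‖W‖ ≤ 1 ∧ CFC.abs A = W ∘L A :=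
  exists_contraction_of_norm_le A (CFC.abs A) fun x => (norm_abs_apply A x).le

theorem ofReal_inner_abs {A W : K →L[ℂ] K} (h : CFC.abs A = W ∘L A) (x : K) :
    ENNReal.ofReal (RCLike.re ⟪x, CFC.abs A x⟫_ℂ) = ‖⟪x, W (A x)⟫_ℂ‖ₑ := by
  have h0 : (CFC.abs A).IsPositive :=
    (ContinuousLinearMap.nonneg_iff_isPositive _).1 (CFC.abs_nonneg A)
  have h1 := h0.inner_nonneg_right x
  have h2 : W (A x) = CFC.abs A x := by rw [h]; rfl
  rw [h2, ← ofReal_norm]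
  congr 1
  obtain ⟨hre, him⟩ := Complex.nonneg_iff.1 h1
  have h3 : ⟪x, CFC.abs A x⟫_ℂ = ((⟪x, CFC.abs A x⟫_ℂ).re : ℂ) :=
    Complex.ext rfl (by simpa using him.symm)
  rw [h3, Complex.norm_real, Real.norm_of_nonneg hre]
  rfl

theorem enorm_le_one_of_norm_le {E : Type*} [SeminormedAddCommGroup E] {W : E} (hW : ‖W‖ ≤ 1) :
    ‖W‖ₑ ≤ 1 := by
  rw [← ofReal_norm]; exact ENNReal.ofReal_le_one.2 hW

theorem tsum_abs_le {ι κ : Type*} (g : HilbertBasis ι ℂ K) (g' : HilbertBasis κ ℂ K)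
    (A : K →L[ℂ] K) :
    ∑' k, ENNReal.ofReal (RCLike.re ⟪g k, CFC.abs A (g k)⟫_ℂ) ≤
      ∑' k, ENNReal.ofReal (RCLike.re ⟪g' k, CFC.abs A (g' k)⟫_ℂ) := by
  obtain ⟨W, hW, h⟩ := exists_contraction_abs A
  rw [tsum_congr fun k => ofReal_inner_abs h (g k)]
  have := tsum_enorm_inner_le_of_basis g' A W (ContinuousLinearMap.id ℂ K) g.orthonormal
    g.orthonormal
  refine this.trans (mul_le_of_le_one_left' ?_)
  exact mul_le_one' (enorm_le_one_of_norm_le hW)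
    (enorm_le_one_of_norm_le ContinuousLinearMap.norm_id_le)

/-- The trace norm can be computed in every orthonormal basis. -/
theorem traceNorm_eq_tsum {ι : Type*} (g : HilbertBasis ι ℂ K) (A : K →L[ℂ] K) :
    traceNorm A = ∑' k, ENNReal.ofReal (RCLike.re ⟪g k, CFC.abs A (g k)⟫_ℂ) :=
  le_antisymm (tsum_abs_le _ _ A) (tsum_abs_le _ _ A)

theorem tsum_enorm_inner_le {κ : Type*} (A : K →L[ℂ] K)
    (B : K →L[ℂ] L) (C : G →L[ℂ] K) {e : κ → G} {f : κ → L} (he : Orthonormal ℂ e)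
    (hf : Orthonormal ℂ f) :
    ∑' i, ‖⟪f i, B (A (C (e i)))⟫_ℂ‖ₑ ≤ ‖B‖ₑ * ‖C‖ₑ * traceNorm A :=
  tsum_enorm_inner_le_of_basis (onb K) A B C he hf

theorem traceNorm_comp_le (A : K →L[ℂ] K) (B : K →L[ℂ] L) (C : L →L[ℂ] K) :
    traceNorm (B ∘L A ∘L C) ≤ ‖B‖ₑ * ‖C‖ₑ * traceNorm A := by
  obtain ⟨W, hW, h⟩ := exists_contraction_abs (B ∘L A ∘L C)
  rw [traceNorm, posTrace, tsum_congr fun k => ofReal_inner_abs h _]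
  refine (tsum_enorm_inner_le A (W ∘L B) C (onb L).orthonormal (onb L).orthonormal).trans ?_
  gcongr
  simp only [← ofReal_norm]
  refine ENNReal.ofReal_le_ofReal ((ContinuousLinearMap.opNorm_comp_le _ _).trans ?_)
  exact mul_le_of_le_one_left (norm_nonneg _) hW

theorem traceNorm_add_le (A B : K →L[ℂ] K) : traceNorm (A + B) ≤ traceNorm A + traceNorm B := by
  obtain ⟨W, hW, h⟩ := exists_contraction_abs (A + B)
  have hW' := enorm_le_one_of_norm_le hW
  have hI : ‖ContinuousLinearMap.id ℂ K‖ₑ ≤ 1 :=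
    enorm_le_one_of_norm_le ContinuousLinearMap.norm_id_le
  have key : ∀ A : K →L[ℂ] K, ∑' k, ‖⟪onb K k, W (A (onb K k))⟫_ℂ‖ₑ ≤ traceNorm A := fun A =>
    (tsum_enorm_inner_le A W (ContinuousLinearMap.id ℂ K) (onb K).orthonormal
      (onb K).orthonormal).trans (mul_le_of_le_one_left' (mul_le_one' hW' hI))
  rw [traceNorm, posTrace, tsum_congr fun k => ofReal_inner_abs h _]
  refine le_trans ?_ (add_le_add (key A) (key B))
  rw [← ENNReal.tsum_add]
  refine ENNReal.tsum_le_tsum fun k => ?_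
  rw [add_apply, map_add, inner_add_right]
  exact enorm_add_le _ _

theorem traceNorm_smul_le (c : ℂ) (A : K →L[ℂ] K) : traceNorm (c • A) ≤ ‖c‖ₑ * traceNorm A := by
  have h := traceNorm_comp_le A (c • ContinuousLinearMap.id ℂ K) (ContinuousLinearMap.id ℂ K)
  have h1 : (c • ContinuousLinearMap.id ℂ K) ∘L A ∘L ContinuousLinearMap.id ℂ K = c • A := by
    ext; simp
  rw [h1] at h
  refine h.trans ?_
  have hI : ‖ContinuousLinearMap.id ℂ K‖ₑ ≤ 1 :=
    enorm_le_one_of_norm_le ContinuousLinearMap.norm_id_le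
  gcongr
  rw [enorm_smul]
  exact (mul_le_of_le_one_right' hI).trans (mul_le_of_le_one_right' hI)

theorem enorm_le_traceNorm (A : K →L[ℂ] K) : ‖A‖ₑ ≤ traceNorm A := by
  rcases eq_or_ne (traceNorm A) ∞ with h | h
  · rw [h]; exact le_top
  have key : ∀ x y : K, ‖x‖ = 1 → ‖y‖ = 1 → ‖⟪y, A x⟫_ℂ‖ ≤ (traceNorm A).toReal := by
    intro x y hx hy
    have hx' : Orthonormal ℂ (fun _ : Unit => x) := by
      refine ⟨fun _ => hx, fun i j hij => absurd (Subsingleton.elim i j) hij⟩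
    have hy' : Orthonormal ℂ (fun _ : Unit => y) := by
      refine ⟨fun _ => hy, fun i j hij => absurd (Subsingleton.elim i j) hij⟩
    have := tsum_enorm_inner_le A (ContinuousLinearMap.id ℂ K) (ContinuousLinearMap.id ℂ K) hx' hy'
    rw [tsum_fintype, Finset.univ_unique, Finset.sum_singleton] at this
    have hI : ‖ContinuousLinearMap.id ℂ K‖ₑ ≤ 1 :=
      enorm_le_one_of_norm_le ContinuousLinearMap.norm_id_le
    have h2 := this.trans (mul_le_of_le_one_left' (mul_le_one' hI hI))
    have h3 := ENNReal.toReal_mono h h2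
    simpa using h3
  rw [← ofReal_norm, ← ENNReal.ofReal_toReal h]
  refine ENNReal.ofReal_le_ofReal (A.opNorm_le_of_re_inner_le ENNReal.toReal_nonneg ?_)
  intro x y hx hy
  rw [← inner_conj_symm, RCLike.conj_re]
  exact (RCLike.re_le_norm _).trans (key x y hx hy)

/-- The subspace of trace-class operators, those with `Tr |A| < ∞`. -/
def traceClassSubmodule (K : Type*) [NormedAddCommGroup K] [InnerProductSpace ℂ K]
    [CompleteSpace K] : Submodule ℂ (K →L[ℂ] K) where
  carrier := {A | traceNorm A < ∞}
  zero_mem' := by simp [traceNorm, posTrace]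
  add_mem' {A B} hA hB := (traceNorm_add_le A B).trans_lt (ENNReal.add_lt_top.2 ⟨hA, hB⟩)
  smul_mem' c A hA := (traceNorm_smul_le c A).trans_lt (ENNReal.mul_lt_top enorm_lt_top hA)

/-- The space of trace-class operators on a Hilbert space. It is a type of its own, so that it
carries the trace norm and not the operator norm. -/
def TraceClass (K : Type*) [NormedAddCommGroup K] [InnerProductSpace ℂ K]
    [CompleteSpace K] : Type _ := traceClassSubmodule K

namespace TraceClass

noncomputable instance : AddCommGroup (TraceClass K) :=
  inferInstanceAs (AddCommGroup (traceClassSubmodule K))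

noncomputable instance : Module ℂ (TraceClass K) :=
  inferInstanceAs (Module ℂ (traceClassSubmodule K))

/-- A trace-class operator as a bounded operator; its norm is the operator norm. -/
def toCLM (A : TraceClass K) : K →L[ℂ] K := A.1

theorem traceNorm_lt_top (A : TraceClass K) : traceNorm A.toCLM < ∞ := A.2

@[ext] theorem ext {A B : TraceClass K} (h : A.toCLM = B.toCLM) : A = B := Subtype.ext h

@[simp] theorem toCLM_zero : (0 : TraceClass K).toCLM = 0 := rfl

@[simp] theorem toCLM_add (A B : TraceClass K) : (A + B).toCLM = A.toCLM + B.toCLM := rfl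

@[simp] theorem toCLM_neg (A : TraceClass K) : (-A).toCLM = -A.toCLM := rfl

@[simp] theorem toCLM_sub (A B : TraceClass K) : (A - B).toCLM = A.toCLM - B.toCLM := rfl

@[simp] theorem toCLM_smul (c : ℂ) (A : TraceClass K) : (c • A).toCLM = c • A.toCLM := rfl

noncomputable instance : Norm (TraceClass K) := ⟨fun A => (traceNorm A.toCLM).toReal⟩

theorem norm_def (A : TraceClass K) : ‖A‖ = (traceNorm A.toCLM).toReal := rfl

theorem norm_toCLM_le (A : TraceClass K) : ‖A.toCLM‖ ≤ ‖A‖ := by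
  rw [norm_def, ← toReal_enorm]
  exact ENNReal.toReal_mono A.traceNorm_lt_top.ne (enorm_le_traceNorm _)

theorem norm_smul_le_aux (c : ℂ) (A : TraceClass K) : ‖c • A‖ ≤ ‖c‖ * ‖A‖ := by
  rw [norm_def, norm_def, ← toReal_enorm c, ← ENNReal.toReal_mul]
  exact ENNReal.toReal_mono (ENNReal.mul_lt_top enorm_lt_top A.traceNorm_lt_top).ne
    (traceNorm_smul_le c _)

theorem core : NormedSpace.Core ℂ (TraceClass K) where
  norm_nonneg _ := ENNReal.toReal_nonneg
  norm_smul c A := by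
    refine le_antisymm (norm_smul_le_aux c A) ?_
    rcases eq_or_ne c 0 with rfl | hc
    · rw [norm_zero, zero_mul]; exact ENNReal.toReal_nonneg
    · have h := norm_smul_le_aux c⁻¹ (c • A)
      rw [smul_smul, inv_mul_cancel₀ hc, one_smul, norm_inv] at h
      rwa [← le_inv_mul_iff₀ (norm_pos_iff.2 hc)]
  norm_triangle A B := by
    rw [norm_def, norm_def, norm_def, ← ENNReal.toReal_add A.traceNorm_lt_top.ne
      B.traceNorm_lt_top.ne]
    exact ENNReal.toReal_mono (ENNReal.add_lt_top.2 ⟨A.traceNorm_lt_top, B.traceNorm_lt_top⟩).ne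
      (traceNorm_add_le _ _)
  norm_eq_zero_iff A := by
    constructor
    · intro h
      have := A.norm_toCLM_le
      rw [h] at this
      exact ext (norm_le_zero_iff.1 this)
    · rintro rfl
      simp [norm_def, traceNorm, posTrace]

/-- The trace norm on the space of trace-class operators. -/
noncomputable instance : NormedAddCommGroup (TraceClass K) := NormedAddCommGroup.ofCore core

noncomputable instance : NormedSpace ℂ (TraceClass K) := NormedSpace.ofCore core

instance : CompleteSpace (TraceClass K) := by
  refine Metric.complete_of_cauchySeq_tendsto fun u hu => ?_
  have hu' : CauchySeq fun n => (u n).toCLM := by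
    rw [Metric.cauchySeq_iff] at hu ⊢
    intro ε hε
    obtain ⟨N, hN⟩ := hu ε hε
    refine ⟨N, fun m hm n hn => lt_of_le_of_lt ?_ (hN m hm n hn)⟩
    rw [dist_eq_norm, dist_eq_norm]
    exact (u m - u n).norm_toCLM_le
  obtain ⟨T, hT⟩ := cauchySeq_tendsto_of_complete hu'
  have key : ∀ ε : ℝ, 0 < ε → ∃ N, ∀ n ≥ N,
      traceNorm ((u n).toCLM - T) ≤ ENNReal.ofReal ε := by
    intro ε hε
    obtain ⟨N, hN⟩ := Metric.cauchySeq_iff.1 hu ε hε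
    refine ⟨N, fun n hn => ?_⟩
    obtain ⟨W, hW, h⟩ := exists_contraction_abs ((u n).toCLM - T)
    rw [traceNorm, posTrace, tsum_congr fun k => ofReal_inner_abs h _, ENNReal.tsum_eq_iSup_sum]
    refine iSup_le fun s => ?_
    have hlim : Filter.Tendsto (fun m => ∑ k ∈ s,
        ‖⟪onb K k, W (((u n).toCLM - (u m).toCLM) (onb K k))⟫_ℂ‖ₑ) Filter.atTop
        (nhds (∑ k ∈ s, ‖⟪onb K k, W (((u n).toCLM - T) (onb K k))⟫_ℂ‖ₑ)) := by
      refine tendsto_finsetSum _ fun k _ => ?_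
      refine (continuous_enorm.tendsto _).comp ?_
      refine Filter.Tendsto.inner tendsto_const_nhds ((W.continuous.tendsto _).comp ?_)
      have h1 : Filter.Tendsto (fun m => (u n).toCLM - (u m).toCLM) Filter.atTop
        (nhds ((u n).toCLM - T)) := tendsto_const_nhds.sub hT
      exact ((ContinuousLinearMap.apply ℂ K (onb K k)).continuous.tendsto _).comp h1
    refine le_of_tendsto hlim (Filter.eventually_atTop.2 ⟨N, fun m hm => ?_⟩)
    have hI : ‖ContinuousLinearMap.id ℂ K‖ₑ ≤ 1 :=
      enorm_le_one_of_norm_le ContinuousLinearMap.norm_id_le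
    have h1 := (ENNReal.sum_le_tsum s).trans (tsum_enorm_inner_le ((u n - u m).toCLM) W
      (ContinuousLinearMap.id ℂ K) (onb K).orthonormal (onb K).orthonormal)
    refine (h1.trans (mul_le_of_le_one_left' (mul_le_one' (enorm_le_one_of_norm_le hW) hI))).trans ?_
    have h2 := (hN n hn m hm).le
    rw [dist_eq_norm, norm_def] at h2
    rw [← ENNReal.ofReal_toReal (u n - u m).traceNorm_lt_top.ne]
    exact ENNReal.ofReal_le_ofReal h2
  have hTmem : traceNorm T < ∞ := by
    obtain ⟨N, hN⟩ := key 1 one_pos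
    have h1 : T = (u N).toCLM + (-1 : ℂ) • ((u N).toCLM - T) := by
      rw [neg_one_smul]; abel
    rw [h1]
    refine (traceNorm_add_le _ _).trans_lt (ENNReal.add_lt_top.2 ⟨(u N).traceNorm_lt_top, ?_⟩)
    exact (traceNorm_smul_le _ _).trans_lt (ENNReal.mul_lt_top enorm_lt_top
      ((hN N le_rfl).trans_lt ENNReal.ofReal_lt_top))
  let T' : TraceClass K := ⟨T, hTmem⟩
  refine ⟨T', Metric.tendsto_atTop.2 fun ε hε => ?_⟩
  obtain ⟨N, hN⟩ := key (ε / 2) (half_pos hε)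
  refine ⟨N, fun n hn => lt_of_le_of_lt ?_ (half_lt_self hε)⟩
  rw [dist_eq_norm, norm_def]
  exact ENNReal.toReal_le_of_le_ofReal (half_pos hε).le (hN n hn)

/-- The trace of a trace-class operator. -/
noncomputable def trace (A : TraceClass K) : ℂ := ∑' i, ⟪onb K i, A.toCLM (onb K i)⟫_ℂ

theorem hasSum_trace_aux {S W A : K →L[ℂ] K} (hS : S† = S) (hA : A = W ∘L S ∘L S)
    (hfin : ∑' k, ‖S (onb K k)‖ₑ ^ 2 < ∞) {ι : Type*} (b : HilbertBasis ι ℂ K) :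
    HasSum (fun i => ⟪b i, A (b i)⟫_ℂ) (∑' k, ⟪S (onb K k), W (S (onb K k))⟫_ℂ) := by
  let F : ι × onbSet K → ℂ := fun p => ⟪b p.1, W (S (onb K p.2))⟫_ℂ * ⟪onb K p.2, S (b p.1)⟫_ℂ
  have hsym : ∀ x y, ⟪x, S y⟫_ℂ = ⟪S x, y⟫_ℂ := fun x y => by
    rw [← ContinuousLinearMap.adjoint_inner_left, hS]
  have hF : Summable F := by
    have hle : ∀ p, ‖F p‖ₑ ≤ ‖⟪b p.1, W (S (onb K p.2))⟫_ℂ‖ₑ ^ 2 + ‖⟪onb K p.2, S (b p.1)⟫_ℂ‖ₑ ^ 2 := by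
      intro p
      rw [enorm_mul]
      rcases le_total ‖⟪b p.1, W (S (onb K p.2))⟫_ℂ‖ₑ ‖⟪onb K p.2, S (b p.1)⟫_ℂ‖ₑ with h | h
      · exact (mul_le_mul_left h _).trans (by rw [← sq]; exact le_add_self)
      · exact (mul_le_mul_right h _).trans (by rw [← sq]; exact le_self_add)
    have h1 : ∑' p, ‖F p‖ₑ ≠ ∞ := by
      refine ((ENNReal.tsum_le_tsum hle).trans_lt ?_).ne
      rw [ENNReal.tsum_add, ENNReal.add_lt_top]
      constructor
      · rw [ENNReal.tsum_prod', ENNReal.tsum_comm]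
        simp only [b.tsum_enorm_inner_sq]
        refine (ENNReal.tsum_le_tsum (g := fun k => ‖W‖ₑ ^ 2 * ‖S (onb K k)‖ₑ ^ 2) fun k => ?_).trans_lt ?_
        · rw [← mul_pow]; gcongr; exact W.le_opENorm _
        · rw [ENNReal.tsum_mul_left]
          exact ENNReal.mul_lt_top (ENNReal.pow_lt_top enorm_lt_top) hfin
      · rw [ENNReal.tsum_prod', ENNReal.tsum_comm]
        refine (ENNReal.tsum_le_tsum (g := fun k => ‖S (onb K k)‖ₑ ^ 2) fun k => ?_).trans_lt hfin
        simp only [hsym]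
        exact b.orthonormal.tsum_enorm_inner_sq_le _
    refine Summable.of_enorm h1
  have h1 := hF.hasSum.prod_fiberwise (g := fun i => ⟪b i, A (b i)⟫_ℂ) (fun i => by
    have := (onb K).hasSum_inner_mul_inner (S ((W†) (b i))) (S (b i))
    have e1 : (fun k => F (i, k)) =
        fun k => ⟪S ((W†) (b i)), onb K k⟫_ℂ * ⟪onb K k, S (b i)⟫_ℂ := by
      funext k
      change ⟪b i, W (S (onb K k))⟫_ℂ * ⟪onb K k, S (b i)⟫_ℂ = _
      rw [← ContinuousLinearMap.adjoint_inner_left W, hsym ((W†) (b i))]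
    have e2 : ⟪b i, A (b i)⟫_ℂ = ⟪S ((W†) (b i)), S (b i)⟫_ℂ := by
      rw [hA, ContinuousLinearMap.comp_apply, ContinuousLinearMap.comp_apply,
        ← ContinuousLinearMap.adjoint_inner_left, hsym]
    rw [e1, e2]
    exact this)
  have h2 := ((Equiv.prodComm _ _).hasSum_iff.2 hF.hasSum).prod_fiberwise
    (g := fun k => ⟪S (onb K k), W (S (onb K k))⟫_ℂ) (fun k => by
      have := b.hasSum_inner_mul_inner (S (onb K k)) (W (S (onb K k)))
      have e1 : (fun i => (F ∘ Equiv.prodComm (onbSet K) ι) (k, i)) =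
          fun i => ⟪S (onb K k), b i⟫_ℂ * ⟪b i, W (S (onb K k))⟫_ℂ := by
        funext i
        change ⟪b i, W (S (onb K k))⟫_ℂ * ⟪onb K k, S (b i)⟫_ℂ = _
        rw [hsym, mul_comm]
      rw [e1]
      exact this)
  rw [h2.tsum_eq]
  exact h1

/-- The trace can be computed in every orthonormal basis. -/
theorem hasSum_trace {ι : Type*} (b : HilbertBasis ι ℂ K) (A : TraceClass K) :
    HasSum (fun i => ⟪b i, A.toCLM (b i)⟫_ℂ) A.trace := by
  obtain ⟨W, hW, hAW⟩ := exists_contraction_of_norm_le (CFC.abs A.toCLM) A.toCLM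
    fun x => (norm_abs_apply A.toCLM x).ge
  have hS : (CFC.sqrt (CFC.abs A.toCLM))† = CFC.sqrt (CFC.abs A.toCLM) :=
    (CFC.sqrt_nonneg (CFC.abs A.toCLM)).isSelfAdjoint
  have hSS : CFC.sqrt (CFC.abs A.toCLM) ∘L CFC.sqrt (CFC.abs A.toCLM) = CFC.abs A.toCLM :=
    CFC.sqrt_mul_sqrt_self _ (CFC.abs_nonneg A.toCLM)
  have hfin : ∑' k, ‖CFC.sqrt (CFC.abs A.toCLM) (onb K k)‖ₑ ^ 2 < ∞ := by
    convert A.traceNorm_lt_top using 1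
    refine tsum_congr fun k => ?_
    conv_rhs => rw [← hSS]
    rw [ContinuousLinearMap.comp_apply, ← ContinuousLinearMap.adjoint_inner_left, hS,
      inner_self_eq_norm_sq, ENNReal.ofReal_pow (norm_nonneg _), ofReal_norm]
  have key := hasSum_trace_aux hS (hAW.trans (by rw [hSS])) hfin (onb K)
  rw [trace, key.tsum_eq]
  exact hasSum_trace_aux hS (hAW.trans (by rw [hSS])) hfin b

/-- The trace-class operator `B A C`, for `A` of trace class and `B`, `C` bounded. -/
def sandwich (B : K →L[ℂ] L) (A : TraceClass K) (C : L →L[ℂ] K) : TraceClass L :=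
  ⟨B ∘L A.toCLM ∘L C, (traceNorm_comp_le _ _ _).trans_lt
    (ENNReal.mul_lt_top (ENNReal.mul_lt_top enorm_lt_top enorm_lt_top) A.traceNorm_lt_top)⟩

@[simp] theorem toCLM_sandwich (B : K →L[ℂ] L) (A : TraceClass K) (C : L →L[ℂ] K) :
    (sandwich B A C).toCLM = B ∘L A.toCLM ∘L C := rfl

end TraceClass

/-- A density operator: a positive trace-class operator with trace one. -/
structure IsDensityOperator (ρ : TraceClass K) : Prop where
  isPositive : ρ.toCLM.IsPositive
  trace_eq_one : ρ.trace = 1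

end TraceClassOperators

section PartialTrace

open scoped InnerProduct

set_option linter.unusedSectionVars false

variable {Hs Hb : Type*}
  [NormedAddCommGroup Hs] [InnerProductSpace ℂ Hs] [CompleteSpace Hs]
  [NormedAddCommGroup Hb] [InnerProductSpace ℂ Hb] [CompleteSpace Hb]

/-- The Hilbert space tensor product: the completion of the algebraic tensor product for
`⟪x ⊗ v, y ⊗ w⟫ = ⟪x, y⟫ * ⟪v, w⟫`. -/
abbrev HilbertTensor (Hs Hb : Type*) [NormedAddCommGroup Hs] [InnerProductSpace ℂ Hs]
    [NormedAddCommGroup Hb] [InnerProductSpace ℂ Hb] : Type _ :=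
  UniformSpace.Completion (TensorProduct ℂ Hs Hb)

/-- The bounded operator `x ↦ x ⊗ v` from `Hs` to `Hs ⊗ Hb`. -/
noncomputable def tensorRight (Hs : Type*) [NormedAddCommGroup Hs] [InnerProductSpace ℂ Hs]
    (v : Hb) : Hs →L[ℂ] HilbertTensor Hs Hb :=
  UniformSpace.Completion.toComplL ∘L (TensorProduct.mkL ℂ Hs Hb).flip v

/-- The bounded operator `v ↦ x ⊗ v` from `Hb` to `Hs ⊗ Hb`. -/
noncomputable def tensorLeft (Hb : Type*) [NormedAddCommGroup Hb] [InnerProductSpace ℂ Hb]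
    (x : Hs) : Hb →L[ℂ] HilbertTensor Hs Hb :=
  UniformSpace.Completion.toComplL ∘L TensorProduct.mkL ℂ Hs Hb x

theorem tensorLeft_apply (x : Hs) (v : Hb) : tensorLeft Hb x v = tensorRight Hs v x := rfl

theorem inner_tensorRight (v w : Hb) (x y : Hs) :
    ⟪tensorRight Hs v x, tensorRight Hs w y⟫_ℂ = ⟪x, y⟫_ℂ * ⟪v, w⟫_ℂ := by
  change ⟪((TensorProduct.tmul ℂ x v : TensorProduct ℂ Hs Hb) : HilbertTensor Hs Hb),
    ((TensorProduct.tmul ℂ y w : TensorProduct ℂ Hs Hb) : HilbertTensor Hs Hb)⟫_ℂ = _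
  rw [UniformSpace.Completion.inner_coe, TensorProduct.inner_tmul]

theorem adjoint_tensorRight_apply (v w : Hb) (x : Hs) :
    ((tensorRight Hs v)†) (tensorRight Hs w x) = ⟪v, w⟫_ℂ • x := by
  refine ext_inner_left ℂ fun y => ?_
  rw [ContinuousLinearMap.adjoint_inner_right, inner_tensorRight, inner_smul_right, mul_comm]

open Classical in
theorem orthonormal_tensorRight {ι κ : Type*} {e : ι → Hs} {b : κ → Hb} (he : Orthonormal ℂ e)
    (hb : Orthonormal ℂ b) : Orthonormal ℂ (fun p : κ × ι => tensorRight Hs (b p.1) (e p.2)) := by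
  rw [orthonormal_iff_ite]
  rintro ⟨j, i⟩ ⟨j', i'⟩
  rw [inner_tensorRight, orthonormal_iff_ite.1 he, orthonormal_iff_ite.1 hb]
  by_cases h1 : i = i' <;> by_cases h2 : j = j' <;> simp [h1, h2]

/-- The diagonal block `V† T V` of `T`, where `V x = x ⊗ v`. -/
noncomputable def diagBlock (T : TraceClass (HilbertTensor Hs Hb)) (v : Hb) : TraceClass Hs :=
  TraceClass.sandwich ((tensorRight Hs v)†) T (tensorRight Hs v)

theorem inner_diagBlock (T : TraceClass (HilbertTensor Hs Hb)) (v : Hb) (x y : Hs) :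
    ⟪x, (diagBlock T v).toCLM y⟫_ℂ = ⟪tensorRight Hs v x, T.toCLM (tensorRight Hs v y)⟫_ℂ := by
  rw [diagBlock, TraceClass.toCLM_sandwich, ContinuousLinearMap.comp_apply,
    ContinuousLinearMap.adjoint_inner_right, ContinuousLinearMap.comp_apply]

open Classical in
theorem sum_norm_diagBlock_le {κ : Type*} {b : κ → Hb} (hb : Orthonormal ℂ b)
    (T : TraceClass (HilbertTensor Hs Hb)) (F : Finset κ) :
    ∑ j ∈ F, ‖diagBlock T (b j)‖ ≤ ‖T‖ := by
  choose W hW hWabs using fun j => exists_contraction_abs (diagBlock T (b j)).toCLM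
  let V : κ → Hs →L[ℂ] HilbertTensor Hs Hb := fun j => tensorRight Hs (b j)
  have hVV : ∀ j k x, ((V j)†) (V k x) = if j = k then x else 0 := fun j k x => by
    rw [adjoint_tensorRight_apply, orthonormal_iff_ite.1 hb]
    split_ifs <;> simp
  have hpyth : ∀ a : κ → Hs, ‖∑ j ∈ F, V j (a j)‖ ^ 2 = ∑ j ∈ F, ‖a j‖ ^ 2 := by
    intro a
    have : ⟪∑ j ∈ F, V j (a j), ∑ j ∈ F, V j (a j)⟫_ℂ = ∑ j ∈ F, ⟪a j, a j⟫_ℂ := by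
      rw [sum_inner]
      refine Finset.sum_congr rfl fun j hj => ?_
      rw [← ContinuousLinearMap.adjoint_inner_right, map_sum]
      simp only [hVV]
      rw [Finset.sum_ite_eq, if_pos hj]
    simp only [inner_self_eq_norm_sq_to_K] at this
    exact_mod_cast this
  have hbessel : ∀ x, ∑ j ∈ F, ‖((V j)†) x‖ ^ 2 ≤ ‖x‖ ^ 2 := by
    intro x
    set y := ∑ j ∈ F, V j (((V j)†) x)
    have h1 : ‖y‖ ^ 2 = ∑ j ∈ F, ‖((V j)†) x‖ ^ 2 := hpyth _
    have h2 : ⟪x, y⟫_ℂ = ((‖y‖ ^ 2 : ℝ) : ℂ) := by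
      rw [h1, inner_sum]
      push_cast
      refine Finset.sum_congr rfl fun j _ => ?_
      rw [← ContinuousLinearMap.adjoint_inner_left, inner_self_eq_norm_sq_to_K]
      rfl
    have h3 : ‖y‖ ^ 2 ≤ ‖x‖ * ‖y‖ := by
      have := norm_inner_le_norm (𝕜 := ℂ) x y
      rwa [h2, Complex.norm_real, Real.norm_of_nonneg (by positivity)] at this
    rw [← h1]
    have h4 : ‖y‖ ≤ ‖x‖ := by
      by_contra! h
      nlinarith [norm_nonneg x]
    gcongr
  let B : HilbertTensor Hs Hb →L[ℂ] HilbertTensor Hs Hb := ∑ j ∈ F, V j ∘L W j ∘L (V j)†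
  have hBapply : ∀ x, B x = ∑ j ∈ F, V j (W j (((V j)†) x)) := fun x => by
    simp [B]
  have hB : ‖B‖ ≤ 1 := by
    refine B.opNorm_le_bound zero_le_one fun x => ?_
    rw [one_mul]
    refine le_of_sq_le_sq ?_ (norm_nonneg _)
    rw [hBapply, hpyth]
    refine (Finset.sum_le_sum fun j _ => ?_).trans (hbessel x)
    gcongr
    exact ((W j).le_opNorm _).trans (mul_le_of_le_one_left (norm_nonneg _) (hW j))
  have hinner : ∀ j ∈ F, ∀ x y, ⟪V j x, B y⟫_ℂ = ⟪x, W j (((V j)†) y)⟫_ℂ := by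
    intro j hj x y
    rw [← ContinuousLinearMap.adjoint_inner_right, hBapply, map_sum]
    simp only [hVV]
    rw [Finset.sum_ite_eq, if_pos hj]
  have hmain := tsum_enorm_inner_le T.toCLM B (ContinuousLinearMap.id ℂ _)
    (orthonormal_tensorRight (onb Hs).orthonormal hb)
    (orthonormal_tensorRight (onb Hs).orthonormal hb)
  have hI : ‖ContinuousLinearMap.id ℂ (HilbertTensor Hs Hb)‖ₑ ≤ 1 :=
    enorm_le_one_of_norm_le ContinuousLinearMap.norm_id_le
  replace hmain := hmain.trans (mul_le_of_le_one_left' (mul_le_one' (enorm_le_one_of_norm_le hB) hI))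
  rw [ENNReal.tsum_prod'] at hmain
  replace hmain := (ENNReal.sum_le_tsum F).trans hmain
  have hterm : ∀ j ∈ F, ∑' i, ‖⟪tensorRight Hs (b j) (onb Hs i), B (T.toCLM
      ((ContinuousLinearMap.id ℂ _) (tensorRight Hs (b j) (onb Hs i))))⟫_ℂ‖ₑ =
      traceNorm (diagBlock T (b j)).toCLM := by
    intro j hj
    rw [traceNorm, posTrace, tsum_congr fun k => ofReal_inner_abs (hWabs j) _]
    refine tsum_congr fun i => ?_
    exact congrArg _ (hinner j hj _ _)
  rw [Finset.sum_congr rfl hterm] at hmain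
  have h5 := ENNReal.toReal_mono T.traceNorm_lt_top.ne hmain
  rwa [ENNReal.toReal_sum fun j _ => (diagBlock T (b j)).traceNorm_lt_top.ne] at h5

theorem summable_diagBlock {κ : Type*} {b : κ → Hb} (hb : Orthonormal ℂ b)
    (T : TraceClass (HilbertTensor Hs Hb)) : Summable fun j => diagBlock T (b j) :=
  Summable.of_norm (summable_of_sum_le (fun _ => norm_nonneg _) (sum_norm_diagBlock_le hb T))

/-- The partial trace `Tr_b T = ∑ⱼ V†ⱼ T Vⱼ`, where `Vⱼ x = x ⊗ bⱼ` for an orthonormal basis `bⱼ`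
of `Hb`. The series converges in trace norm. -/
noncomputable def partialTrace (T : TraceClass (HilbertTensor Hs Hb)) : TraceClass Hs :=
  ∑' j, diagBlock T (onb Hb j)

theorem TraceClass.hasSum_inner {κ : Type*} {u : κ → TraceClass Hs} {A : TraceClass Hs}
    (h : HasSum u A) (x y : Hs) : HasSum (fun j => ⟪x, (u j).toCLM y⟫_ℂ) ⟪x, A.toCLM y⟫_ℂ := by
  let ℓ : TraceClass Hs →ₗ[ℂ] ℂ :=
    { toFun := fun B => ⟪x, B.toCLM y⟫_ℂ
      map_add' := fun B C => by simp
      map_smul' := fun c B => by simp }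
  refine h.map ℓ (ℓ.mkContinuous (‖x‖ * ‖y‖) fun B => ?_).continuous
  calc ‖⟪x, B.toCLM y⟫_ℂ‖ ≤ ‖x‖ * ‖B.toCLM y‖ := norm_inner_le_norm _ _
    _ ≤ ‖x‖ * (‖B‖ * ‖y‖) := by
        gcongr
        exact (B.toCLM.le_opNorm y).trans (by gcongr; exact B.norm_toCLM_le)
    _ = ‖x‖ * ‖y‖ * ‖B‖ := by ring

/-- The partial trace does not depend on the orthonormal basis: its matrix elements are given by
the usual formula in every orthonormal basis. -/
theorem hasSum_inner_partialTrace {κ : Type*} (b : HilbertBasis κ ℂ Hb)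
    (T : TraceClass (HilbertTensor Hs Hb)) (x y : Hs) :
    HasSum (fun j => ⟪tensorRight Hs (b j) x, T.toCLM (tensorRight Hs (b j) y)⟫_ℂ)
      ⟪x, (partialTrace T).toCLM y⟫_ℂ := by
  let R : TraceClass Hb := TraceClass.sandwich ((tensorLeft Hb x)†) T (tensorLeft Hb y)
  have hR : ∀ v, ⟪v, R.toCLM v⟫_ℂ = ⟪tensorRight Hs v x, T.toCLM (tensorRight Hs v y)⟫_ℂ :=
    fun v => by
      rw [TraceClass.toCLM_sandwich, ContinuousLinearMap.comp_apply,
        ContinuousLinearMap.adjoint_inner_right, ContinuousLinearMap.comp_apply]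
      rfl
  have h1 := R.hasSum_trace b
  have h2 := R.hasSum_trace (onb Hb)
  have h3 := TraceClass.hasSum_inner (summable_diagBlock (onb Hb).orthonormal T).hasSum x y
  simp only [hR] at h1 h2
  simp only [inner_diagBlock] at h3
  have h4 : ⟪x, (partialTrace T).toCLM y⟫_ℂ = R.trace := h3.unique h2
  rw [h4]
  exact h1

end PartialTrace

section UnitaryGroup

set_option linter.unusedSectionVars false

variable {K : Type*} [NormedAddCommGroup K] [InnerProductSpace ℂ K] [CompleteSpace K]

/-- `U` is the strongly continuous one-parameter unitary group with generator `-iH`: the vectors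
`x` at which `t ↦ U t x` is differentiable at `0` are those of the domain of `H`, and the derivative there
is `-i H x`. -/
structure IsUnitaryGroupOf (H : K →ₗ.[ℂ] K) (U : ℝ → K ≃ₗᵢ[ℂ] K) : Prop where
  map_zero : ∀ x, U 0 x = x
  map_add : ∀ s t x, U (s + t) x = U s (U t x)
  continuous : ∀ x, Continuous fun t => U t x
  hasDerivAt_iff : ∀ x y, HasDerivAt (fun t => U t x) (-Complex.I • y) 0 ↔ (x, y) ∈ H.graph

theorem IsUnitaryGroupOf.hasDerivAt {H : K →ₗ.[ℂ] K} {U : ℝ → K ≃ₗᵢ[ℂ] K}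
    (hU : IsUnitaryGroupOf H U) {x y : K} (h : (x, y) ∈ H.graph) (t : ℝ) :
    HasDerivAt (fun t => U t x) (-Complex.I • U t y) t := by
  have h1 := (hU.hasDerivAt_iff x y).2 h
  have h2 : HasDerivAt (fun s => U (s - t) x) (-Complex.I • y) t :=
    HasDerivAt.comp_sub_const t t (by rw [sub_self]; exact h1)
  have h3 := ((U t).toContinuousLinearEquiv.toContinuousLinearMap.restrictScalars
    ℝ).hasFDerivAt.comp_hasDerivAt t h2
  refine (h3.congr_deriv ?_).congr_of_eventuallyEq (Filter.Eventually.of_forall fun s => ?_)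
  · exact (U t).toLinearEquiv.map_smul _ _
  · have := hU.map_add t (s - t) x
    rw [add_sub_cancel] at this
    exact this

theorem IsUnitaryGroupOf.mem_graph {H : K →ₗ.[ℂ] K} {U : ℝ → K ≃ₗᵢ[ℂ] K}
    (hU : IsUnitaryGroupOf H U) {x y : K} (h : (x, y) ∈ H.graph) (t : ℝ) :
    (U t x, U t y) ∈ H.graph := by
  refine (hU.hasDerivAt_iff _ _).1 ?_
  have h1 := hU.hasDerivAt h t
  have h2 : HasDerivAt (fun s => U (s + t) x) (-Complex.I • U t y) 0 :=
    HasDerivAt.comp_add_const 0 t (by rw [zero_add]; exact h1)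
  simpa only [hU.map_add] using h2

/-- The unitary group generated by a self-adjoint operator is unique. -/
theorem IsUnitaryGroupOf.unique {H : K →ₗ.[ℂ] K} (hH : IsSelfAdjoint H) {U V : ℝ → K ≃ₗᵢ[ℂ] K}
    (hU : IsUnitaryGroupOf H U) (hV : IsUnitaryGroupOf H V) : U = V := by
  have hsymm : ∀ {x y : K}, (x, y) ∈ H.graph → (⟪x, y⟫_ℂ).im = 0 := by
    intro x y h
    obtain ⟨a, rfl, rfl⟩ := (LinearPMap.mem_graph_iff H).1 h
    have h1 := LinearPMap.adjoint_isFormalAdjoint hH.dense_domain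
    rw [LinearPMap.isSelfAdjoint_def.1 hH] at h1
    have h2 := h1 a a
    have h3 := inner_conj_symm (𝕜 := ℂ) (a : K) (H a)
    rw [h2] at h3
    exact Complex.conj_eq_iff_im.1 h3
  funext t
  have key : ∀ x ∈ H.domain, U t x = V t x := by
    intro x hx
    have hg : (x, H ⟨x, hx⟩) ∈ H.graph := LinearPMap.mem_graph H ⟨x, hx⟩
    set y := H ⟨x, hx⟩
    have hd : ∀ s, HasDerivAt (fun s => U s x - V s x) (-Complex.I • (U s y - V s y)) s :=
      fun s => ((hU.hasDerivAt hg s).sub (hV.hasDerivAt hg s)).congr_deriv (smul_sub _ _ _).symm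
    have hz : ∀ s, HasDerivAt (fun s => ‖U s x - V s x‖ ^ 2) 0 s := by
      intro s
      have h1 := (hd s).inner ℂ (hd s)
      have hmem : (U s x - V s x, U s y - V s y) ∈ H.graph :=
        H.graph.sub_mem (hU.mem_graph hg s) (hV.mem_graph hg s)
      have h2 := hsymm hmem
      have h4 : (⟪U s y - V s y, U s x - V s x⟫_ℂ).im = 0 := by
        rw [← inner_conj_symm, Complex.conj_im, h2, neg_zero]
      have h3 := Complex.reCLM.hasFDerivAt.comp_hasDerivAt s h1
      refine (h3.congr_deriv ?_).congr_of_eventuallyEq (Filter.Eventually.of_forall fun r => ?_)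
      · rw [Complex.reCLM_apply, inner_smul_right, inner_smul_left,
          Complex.add_re]
        simp [h2, h4]
      · simp only [Function.comp, Complex.reCLM_apply]
        exact norm_sq_eq_re_inner (𝕜 := ℂ) _
    have hc := is_const_of_deriv_eq_zero (fun s => (hz s).differentiableAt)
      (fun s => (hz s).deriv) t 0
    simp only [hU.map_zero, hV.map_zero, sub_self, norm_zero] at hc
    rw [← sub_eq_zero, ← norm_eq_zero]
    exact pow_eq_zero_iff two_ne_zero |>.1 (by simpa using hc)
  ext x
  exact congrFun (Continuous.ext_on hH.dense_domain (U t).continuous (V t).continuous key) x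

open Classical in
/-- The unitary group `t ↦ e^{-iHt}` of a self-adjoint operator `H` (the identity if there is no
such group). -/
noncomputable def unitaryGroup (H : K →ₗ.[ℂ] K) : ℝ → K ≃ₗᵢ[ℂ] K :=
  if h : ∃ U, IsUnitaryGroupOf H U then h.choose else fun _ => LinearIsometryEquiv.refl ℂ K

/-- The evolved operator `e^{-iHt} ρ e^{iHt}`. -/
noncomputable def evolve (H : K →ₗ.[ℂ] K) (ρ : TraceClass K) (t : ℝ) : TraceClass K :=
  ρ.sandwich (unitaryGroup H t : K →L[ℂ] K) (unitaryGroup H (-t) : K →L[ℂ] K)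

end UnitaryGroup

section ReducedState

variable {Hs Hb : Type*}
  [NormedAddCommGroup Hs] [InnerProductSpace ℂ Hs] [CompleteSpace Hs]
  [NormedAddCommGroup Hb] [InnerProductSpace ℂ Hb] [CompleteSpace Hb]

/-- The reduced state `σ(t) = Tr_b [e^{-iHt} ρ₀ e^{iHt}]`. -/
noncomputable def reducedState (H : HilbertTensor Hs Hb →ₗ.[ℂ] HilbertTensor Hs Hb)
    (ρ₀ : TraceClass (HilbertTensor Hs Hb)) (t : ℝ) : TraceClass Hs :=
  partialTrace (evolve H ρ₀ t)

/-- The Laplace transform `σ̃(z) = ∫₀^∞ e^{izt} σ(t) dt` of the reduced state, a Bochner integral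
in the space of trace-class operators with the trace norm. -/
noncomputable def reducedStateLaplace (H : HilbertTensor Hs Hb →ₗ.[ℂ] HilbertTensor Hs Hb)
    (ρ₀ : TraceClass (HilbertTensor Hs Hb)) (z : ℂ) : TraceClass Hs :=
  ∫ t in Set.Ioi (0 : ℝ), Complex.exp (Complex.I * z * t) • reducedState H ρ₀ t

end ReducedState

/-! ### Resolvents and Yosida approximations of a self-adjoint operator -/

section SelfAdjointResolvent

open Filter Topology

/-! The deep ingredient is Stone's theorem, proved by Yosida approximation. For self-adjoint `H` and
real `r ≠ 0` the identity `‖(H - ir)x‖² = ‖Hx‖² + r²‖x‖²` makes `H - ir` injective with closed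
range. A vector orthogonal to the range would be an eigenvector of `H` with eigenvalue `-ir`, so the
range is everything. The resolvents yield commuting bounded self-adjoint operators `A n`, formally
`a²H(H² + a²)⁻¹` with `a = n + 1`, which tend strongly to `H` on its domain. The unitary groups
`exp(-i t A n)` then converge strongly, and the limit is differentiable at `0` on the domain of `H`
with derivative `-iH`. Its generator cannot be larger, because self-adjoint operators are maximal
symmetric (`IsUnitaryGroupOf.of_hasDerivAt`).

Strong continuity of the group gives trace-norm continuity of the evolution as follows. With `S =
√ρ`, the evolved operator is the sum of the rank-one operators `|U t S eₖ⟩⟨U t S eₖ|`. Each is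
continuous in `t`, and its trace norm is at most `‖S eₖ‖²`, whose sum is `Tr ρ`; the Weierstrass
test concludes (`continuous_evolve`).

The partial trace is a contraction for the trace norms, by the estimate `sum_norm_diagBlock_le`, and
conjugation by unitaries does not increase the trace norm, so `‖σ(t)‖ ≤ ‖ρ₀‖ = 1` in trace norm. The
operator norm is at most the trace norm. The Laplace integrand is thus dominated by `exp(-t Im z)`,
whose integral is `1 / Im z`. Differentiation under the integral sign gives complex
differentiability on an open set, hence analyticity, since the trace class is complete. -/

theorem tendsto_of_dense_of_contraction {E ι : Type*} [NormedAddCommGroup E] {l : Filter ι} {T : ι → E → E}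
    (hT : ∀ i x y, ‖T i x - T i y‖ ≤ ‖x - y‖) {S : Set E} (hS : Dense S)
    (h : ∀ x ∈ S, Tendsto (fun i => T i x) l (𝓝 x)) (x : E) :
    Tendsto (fun i => T i x) l (𝓝 x) := by
  refine Metric.tendsto_nhds.2 fun ε hε => ?_
  obtain ⟨y, hy, hxy⟩ := hS.exists_dist_lt x (show 0 < ε / 3 by positivity)
  filter_upwards [Metric.tendsto_nhds.1 (h y hy) (ε / 3) (by positivity)] with i hi
  have h1 : dist (T i x) (T i y) ≤ dist x y := by
    simpa only [dist_eq_norm] using hT i x y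
  have h2 := dist_triangle4 (T i x) (T i y) y x
  rw [dist_comm y x] at h2
  linarith

variable {K : Type*} [NormedAddCommGroup K] [InnerProductSpace ℂ K] [CompleteSpace K]
  {H : K →ₗ.[ℂ] K}

theorem IsSelfAdjoint.inner_eq_of_mem_graph (hH : IsSelfAdjoint H) {x y x' y' : K}
    (h : (x, y) ∈ H.graph) (h' : (x', y') ∈ H.graph) : ⟪y, x'⟫_ℂ = ⟪x, y'⟫_ℂ := by
  obtain ⟨a, rfl, rfl⟩ := (LinearPMap.mem_graph_iff H).1 h
  obtain ⟨b, rfl, rfl⟩ := (LinearPMap.mem_graph_iff H).1 h'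
  have h1 := LinearPMap.adjoint_isFormalAdjoint hH.dense_domain
  rw [LinearPMap.isSelfAdjoint_def.1 hH] at h1
  exact h1 a b

/-- Maximality: the hypothesis says that `x` lies in the domain of the adjoint and is sent to `y` by
it, and the adjoint is `H` itself. -/
theorem IsSelfAdjoint.mem_graph_of_inner_eq (hH : IsSelfAdjoint H) {x y : K}
    (h : ∀ x' y', (x', y') ∈ H.graph → ⟪y, x'⟫_ℂ = ⟪x, y'⟫_ℂ) : (x, y) ∈ H.graph := by
  have h1 : ∀ a : H.domain, ⟪y, (a : K)⟫_ℂ = ⟪x, H a⟫_ℂ := fun a => h _ _ (H.mem_graph a)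
  have hx := LinearPMap.mem_adjoint_domain_of_exists x ⟨y, h1⟩
  have hy := LinearPMap.adjoint_apply_eq hH.dense_domain ⟨x, hx⟩ h1
  rw [← LinearPMap.isSelfAdjoint_def.1 hH, LinearPMap.mem_graph_iff]
  exact ⟨⟨x, hx⟩, rfl, hy⟩

/-- By symmetry `⟪y, x⟫` is real, so the cross term, the real part of `ir⟪y, x⟫` up to a factor,
vanishes. -/
theorem IsSelfAdjoint.norm_sub_smul_sq (hH : IsSelfAdjoint H) {x y : K} (h : (x, y) ∈ H.graph)
    (r : ℝ) : ‖y - ((r : ℂ) * Complex.I) • x‖ ^ 2 = ‖y‖ ^ 2 + r ^ 2 * ‖x‖ ^ 2 := by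
  have h1 : (⟪y, x⟫_ℂ).im = 0 := by
    have h2 := inner_conj_symm (𝕜 := ℂ) y x
    rw [← hH.inner_eq_of_mem_graph h h] at h2
    exact Complex.conj_eq_iff_im.1 h2
  rw [norm_sub_sq (𝕜 := ℂ), inner_smul_right, norm_smul, mul_pow]
  simp [h1]

theorem IsSelfAdjoint.norm_le_norm_sub_smul (hH : IsSelfAdjoint H) {x y : K}
    (h : (x, y) ∈ H.graph) (r : ℝ) : ‖y‖ ≤ ‖y - ((r : ℂ) * Complex.I) • x‖ := by
  refine le_of_sq_le_sq ?_ (norm_nonneg _)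
  rw [hH.norm_sub_smul_sq h]
  nlinarith [mul_nonneg (sq_nonneg r) (sq_nonneg ‖x‖)]

theorem IsSelfAdjoint.abs_mul_norm_le_norm_sub_smul (hH : IsSelfAdjoint H) {x y : K}
    (h : (x, y) ∈ H.graph) (r : ℝ) : |r| * ‖x‖ ≤ ‖y - ((r : ℂ) * Complex.I) • x‖ := by
  refine le_of_sq_le_sq ?_ (norm_nonneg _)
  rw [hH.norm_sub_smul_sq h, mul_pow, sq_abs]
  nlinarith [sq_nonneg ‖y‖]

/-- The graph of `H` is closed, hence complete, and `(x, y) ↦ y - irx` is bounded below on it, so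
its range is closed. It remains to see that nothing is orthogonal to the range. -/
theorem IsSelfAdjoint.exists_mem_graph_sub_smul_eq (hH : IsSelfAdjoint H) {r : ℝ} (hr : r ≠ 0)
    (w : K) : ∃ x y, (x, y) ∈ H.graph ∧ y - ((r : ℂ) * Complex.I) • x = w := by
  let f : H.graph →L[ℂ] K := (ContinuousLinearMap.snd ℂ K K -
    ((r : ℂ) * Complex.I) • ContinuousLinearMap.fst ℂ K K) ∘L H.graph.subtypeL
  have hf : ∀ p : H.graph, f p = p.1.2 - ((r : ℂ) * Complex.I) • p.1.1 := fun p => rfl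
  have hrpos : 0 < |r| := abs_pos.2 hr
  -- The graph carries the sup norm; the two components are bounded by `‖f p‖` and `|r|⁻¹ * ‖f p‖`,
  -- and the constant is the sum of the two factors.
  have hanti : AntilipschitzWith (Real.toNNReal (1 + |r|⁻¹)) f := by
    refine ContinuousLinearMap.antilipschitz_of_bound f fun p => ?_
    rw [Real.coe_toNNReal _ (by positivity)]
    have h1 := hH.norm_le_norm_sub_smul (x := p.1.1) (y := p.1.2) p.2 r
    have h2 := hH.abs_mul_norm_le_norm_sub_smul (x := p.1.1) (y := p.1.2) p.2 r
    rw [← hf] at h1 h2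
    rw [← le_inv_mul_iff₀ hrpos] at h2
    change max ‖p.1.1‖ ‖p.1.2‖ ≤ _
    have h3 : 0 ≤ |r|⁻¹ * ‖f p‖ := by positivity
    refine max_le ?_ ?_ <;> nlinarith [norm_nonneg (f p)]
  have : CompleteSpace H.graph := hH.isClosed.completeSpace_coe
  have hclosed : IsClosed (LinearMap.range (f : H.graph →ₗ[ℂ] K) : Set K) :=
    hanti.isClosed_range f.uniformContinuous
  have : CompleteSpace (LinearMap.range (f : H.graph →ₗ[ℂ] K)) := hclosed.completeSpace_coe
  have htop : LinearMap.range (f : H.graph →ₗ[ℂ] K) = ⊤ := by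
    rw [← Submodule.orthogonal_eq_bot_iff, Submodule.eq_bot_iff]
    intro v hv
    -- Orthogonality to the range says exactly that `v` is in the domain of the adjoint with image
    -- `-irv`. The lower bound for `H + ir` then forces `v = 0`.
    have h1 : (v, ((-r : ℝ) * Complex.I : ℂ) • v) ∈ H.graph := by
      refine hH.mem_graph_of_inner_eq fun x y hxy => ?_
      have h2 := (Submodule.mem_orthogonal' _ v).1 hv (f ⟨(x, y), hxy⟩) ⟨_, rfl⟩
      rw [hf, inner_sub_right, inner_smul_right, sub_eq_zero] at h2
      rw [h2, inner_smul_left]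
      simp
    have h2 := hH.abs_mul_norm_le_norm_sub_smul h1 (-r)
    rw [sub_self, norm_zero, abs_neg] at h2
    have h3 : ‖v‖ ≤ 0 := by
      by_contra! h
      nlinarith
    exact norm_le_zero_iff.1 h3
  obtain ⟨p, hp⟩ : w ∈ LinearMap.range (f : H.graph →ₗ[ℂ] K) := htop ▸ Submodule.mem_top
  exact ⟨p.1.1, p.1.2, p.2, hp⟩

theorem IsSelfAdjoint.eq_of_sub_smul_eq (hH : IsSelfAdjoint H) {r : ℝ} (hr : r ≠ 0)
    {x y x' y' : K} (h : (x, y) ∈ H.graph) (h' : (x', y') ∈ H.graph)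
    (he : y - ((r : ℂ) * Complex.I) • x = y' - ((r : ℂ) * Complex.I) • x') : x = x' := by
  have h1 := hH.abs_mul_norm_le_norm_sub_smul (H.graph.sub_mem h h') r
  have h2 : (y - y') - ((r : ℂ) * Complex.I) • (x - x') = 0 := by
    rw [smul_sub, sub_sub_sub_comm, he, sub_self]
  simp only [h2, norm_zero] at h1
  have h3 : ‖x - x'‖ ≤ 0 := by
    by_contra! h
    nlinarith [abs_pos.2 hr]
  exact sub_eq_zero.1 (norm_le_zero_iff.1 h3)

/-- The resolvent `(H - i r)⁻¹` of a self-adjoint operator, for `r ≠ 0`. -/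
theorem IsSelfAdjoint.exists_resolvent (hH : IsSelfAdjoint H) {r : ℝ} (hr : r ≠ 0) :
    ∃ R : K →L[ℂ] K, ∀ w, (R w, w + ((r : ℂ) * Complex.I) • R w) ∈ H.graph := by
  have hex : ∀ w, ∃ x, (x, w + ((r : ℂ) * Complex.I) • x) ∈ H.graph := fun w => by
    obtain ⟨x, y, hxy, rfl⟩ := hH.exists_mem_graph_sub_smul_eq hr w
    exact ⟨x, by rwa [sub_add_cancel]⟩
  choose R hR using hex
  let R' : K →ₗ[ℂ] K :=
    { toFun := R
      map_add' := fun v w => by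
        refine hH.eq_of_sub_smul_eq hr (hR _) (H.graph.add_mem (hR v) (hR w)) ?_
        simp only [add_sub_cancel_right, smul_add]
        abel
      map_smul' := fun c w => by
        refine hH.eq_of_sub_smul_eq hr (hR _) (H.graph.smul_mem c (hR w)) ?_
        simp only [add_sub_cancel_right, smul_add, RingHom.id_apply]
        rw [smul_comm c]
        abel }
  refine ⟨R'.mkContinuous |r|⁻¹ fun w => ?_, hR⟩
  have := hH.abs_mul_norm_le_norm_sub_smul (hR w) r
  rwa [add_sub_cancel_right, ← le_inv_mul_iff₀ (abs_pos.2 hr)] at this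

/-- A self-adjoint operator is the strong limit, on its domain, of commuting bounded self-adjoint
operators (its Yosida approximations). -/
theorem IsSelfAdjoint.exists_bounded_approximation (hH : IsSelfAdjoint H) :
    ∃ A : ℕ → K →L[ℂ] K, (∀ n, IsSelfAdjoint (A n)) ∧ (∀ m n, Commute (A m) (A n)) ∧
      ∀ x y, (x, y) ∈ H.graph → Tendsto (fun n => A n x) atTop (𝓝 y) ∧ ∀ n, ‖A n x‖ ≤ ‖y‖ := by
  choose R hR using fun r : {r : ℝ // r ≠ 0} => hH.exists_resolvent r.2
  have hleft : ∀ r {x y}, (x, y) ∈ H.graph → R r (y - ((r : ℂ) * Complex.I) • x) = x :=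
    fun r x y h => hH.eq_of_sub_smul_eq r.2 (hR r _) h (by rw [add_sub_cancel_right])
  have hbound : ∀ (r : {r : ℝ // r ≠ 0}) w, |(r : ℝ)| * ‖R r w‖ ≤ ‖w‖ := fun r w => by
    have := hH.abs_mul_norm_le_norm_sub_smul (hR r w) r
    rwa [add_sub_cancel_right] at this
  -- The resolvent identity, from applying `R r` to `(H - ir)(R s w)`.
  have hres : ∀ r s w, R s w = R r w + (((s : ℂ) - r) * Complex.I) • R r (R s w) := by
    intro r s w
    have h1 := hleft r (hR s w)
    rw [← map_smul, ← map_add, ← h1]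
    congr 1
    rw [h1]
    module
  have hcomm : ∀ r s, Commute (R r) (R s) := by
    intro r s
    rcases eq_or_ne r s with rfl | hrs
    · exact Commute.refl _
    have hne : ((s : ℂ) - r) * Complex.I ≠ 0 := by
      refine mul_ne_zero (sub_ne_zero.2 fun h => hrs (Subtype.ext ?_)) Complex.I_ne_zero
      exact_mod_cast h.symm
    -- Exchanging `r` and `s` in the resolvent identity negates both the difference of resolvents
    -- and the scalar, so the two products agree after multiplication by a nonzero scalar.
    ext w
    refine smul_right_injective K hne ?_
    have h1 := hres r s w
    have h2 := hres s r w
    change (((s : ℂ) - r) * Complex.I) • R r (R s w) = (((s : ℂ) - r) * Complex.I) • R s (R r w)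
    have h3 : (((s : ℂ) - r) * Complex.I) • R s (R r w)
        = -((((r : ℂ) - s) * Complex.I) • R s (R r w)) := by module
    rw [h3, ← sub_eq_iff_eq_add'.2 h1, ← sub_eq_iff_eq_add'.2 h2]
    abel
  have hadj : ∀ r v w, ⟪R r v, w⟫_ℂ = ⟪v, R ⟨-r, neg_ne_zero.2 r.2⟩ w⟫_ℂ := by
    intro r v w
    have h := hH.inner_eq_of_mem_graph (hR r v) (hR ⟨-r, neg_ne_zero.2 r.2⟩ w)
    rw [inner_add_left, inner_add_right, inner_smul_left, inner_smul_right] at h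
    simp only [map_mul, Complex.conj_ofReal, Complex.conj_I, Complex.ofReal_neg] at h
    linear_combination -h
  let p : ℕ → {r : ℝ // r ≠ 0} := fun n => ⟨n + 1, by positivity⟩
  let q : ℕ → {r : ℝ // r ≠ 0} := fun n => ⟨-(n + 1), neg_ne_zero.2 (by positivity)⟩
  let a : ℕ → ℝ := fun n => n + 1
  have hapos : ∀ n, 0 < a n := fun n => by positivity
  -- Half the sum of the resolvents at `ia` and `-ia` is formally `H(H² + a²)⁻¹`. As these
  -- resolvents are adjoint to each other, the sum is self-adjoint.
  let A : ℕ → K →L[ℂ] K := fun n => ((a n ^ 2 / 2 : ℝ) : ℂ) • (R (p n) + R (q n))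
  -- Formally `-ir(H - ir)⁻¹`: a contraction that tends strongly to the identity as `|r| → ∞`.
  let T : {r : ℝ // r ≠ 0} → K →L[ℂ] K := fun r => (-((r : ℂ) * Complex.I)) • R r
  have hT : ∀ r w, ‖T r w‖ ≤ ‖w‖ := fun r w => by
    have h : ‖T r w‖ = |(r : ℝ)| * ‖R r w‖ := by
      change ‖(-((r : ℂ) * Complex.I)) • R r w‖ = _
      rw [norm_smul, norm_neg, norm_mul, Complex.norm_I, mul_one, Complex.norm_real,
        Real.norm_eq_abs]
    rw [h]
    exact hbound r w
  have hTsub : ∀ r {x y}, (x, y) ∈ H.graph → T r x = x - R r y := fun r x y h => by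
    have h1 := hleft r h
    rw [map_sub, map_smul, sub_eq_iff_eq_add] at h1
    rw [h1]
    change (-((r : ℂ) * Complex.I)) • R r x = _
    module
  -- Each summand on the right expands to `∓ia x + a² R x`; the terms in `x` cancel between the two
  -- signs. This form gives both the limit and the uniform bound `‖A n x‖ ≤ ‖H x‖`.
  have hA : ∀ n {x y}, (x, y) ∈ H.graph → A n x = (1 / 2 : ℂ) • (T (p n) y + T (q n) y) := by
    intro n x y h
    have h1 := hTsub (p n) h
    have h2 := hTsub (q n) h
    have h3 : R (p n) y = x - T (p n) x := by rw [h1]; abel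
    have h4 : R (q n) y = x - T (q n) x := by rw [h2]; abel
    change ((a n ^ 2 / 2 : ℝ) : ℂ) • (R (p n) x + R (q n) x) =
      (1 / 2 : ℂ) • ((-((p n : ℂ) * Complex.I)) • R (p n) y +
        (-((q n : ℂ) * Complex.I)) • R (q n) y)
    rw [h3, h4]
    change ((a n ^ 2 / 2 : ℝ) : ℂ) • (R (p n) x + R (q n) x) =
      (1 / 2 : ℂ) • ((-((a n : ℝ) * Complex.I : ℂ)) • (x - (-((a n : ℝ) * Complex.I : ℂ)) • R (p n) x) +
        (-(((-a n : ℝ) : ℂ) * Complex.I)) • (x - (-(((-a n : ℝ) : ℂ) * Complex.I)) • R (q n) x))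
    push_cast
    have e : ((a n : ℂ)) ^ 2 / 2 = -(1 / 2) * ((a n : ℂ) * Complex.I) ^ 2 := by
      rw [mul_pow, Complex.I_sq]; ring
    rw [e]
    module
  -- On the domain `T r x - x = -R r (H x)` has norm at most `‖H x‖ / |r|`; density and
  -- contractivity extend the convergence to every vector.
  have hlim : ∀ s : ℕ → {r : ℝ // r ≠ 0}, (∀ n, |(s n : ℝ)| = a n) → ∀ y,
      Tendsto (fun n => T (s n) y) atTop (𝓝 y) := by
    intro s hs
    refine tendsto_of_dense_of_contraction (T := fun n => T (s n)) (fun n v w => ?_)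
      hH.dense_domain fun x hx => ?_
    · rw [← map_sub]; exact hT _ _
    · have hg : (x, H ⟨x, hx⟩) ∈ H.graph := LinearPMap.mem_graph H ⟨x, hx⟩
      rw [tendsto_iff_norm_sub_tendsto_zero]
      refine squeeze_zero (g := fun n : ℕ => ‖H ⟨x, hx⟩‖ * (1 / ((n : ℝ) + 1)))
        (fun _ => norm_nonneg _) (fun n => ?_) ?_
      · rw [hTsub _ hg, sub_sub_cancel_left, norm_neg, mul_one_div, le_div_iff₀ (hapos n), mul_comm]
        have := hbound (s n) (H ⟨x, hx⟩)
        rwa [hs] at this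
      · simpa using (tendsto_one_div_add_atTop_nhds_zero_nat (𝕜 := ℝ)).const_mul ‖H ⟨x, hx⟩‖
  refine ⟨A, fun n => ?_, fun m n => ?_, fun x y h => ⟨?_, fun n => ?_⟩⟩
  · rw [ContinuousLinearMap.isSelfAdjoint_iff_isSymmetric]
    intro v w
    change ⟪((a n ^ 2 / 2 : ℝ) : ℂ) • (R (p n) v + R (q n) v), w⟫_ℂ =
      ⟪v, ((a n ^ 2 / 2 : ℝ) : ℂ) • (R (p n) w + R (q n) w)⟫_ℂ
    have h1 := hadj (p n) v w
    have h2 := hadj (q n) v w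
    have e1 : (⟨-(p n : ℝ), neg_ne_zero.2 (p n).2⟩ : {r : ℝ // r ≠ 0}) = q n := rfl
    have e2 : (⟨-(q n : ℝ), neg_ne_zero.2 (q n).2⟩ : {r : ℝ // r ≠ 0}) = p n :=
      Subtype.ext (neg_neg _)
    rw [e1] at h1
    rw [e2] at h2
    rw [inner_smul_left, inner_smul_right, inner_add_left, inner_add_right, h1, h2,
      Complex.conj_ofReal, add_comm]
  · refine Commute.smul_left (Commute.smul_right ?_ _) _
    exact ((hcomm _ _).add_right (hcomm _ _)).add_left ((hcomm _ _).add_right (hcomm _ _))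
  · have h1 := hlim p (fun n => abs_of_pos (hapos n)) y
    have h2 := hlim q (fun n => (abs_neg _).trans (abs_of_pos (hapos n))) y
    have h3 := (h1.add h2).const_smul (1 / 2 : ℂ)
    have e : (1 / 2 : ℂ) • (y + y) = y := by module
    rw [e] at h3
    exact h3.congr fun n => (hA n h).symm
  · rw [hA n h, norm_smul]
    have := norm_add_le (T (p n) y) (T (q n) y)
    have h1 := hT (p n) y
    have h2 := hT (q n) y
    have e : ‖(1 / 2 : ℂ)‖ = 1 / 2 := by norm_num
    rw [e]
    linarith

end SelfAdjointResolvent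

/-! ### Unitary groups of bounded self-adjoint operators -/

section BoundedUnitaryGroup

variable {K : Type*} [NormedAddCommGroup K] [InnerProductSpace ℂ K] [CompleteSpace K]

/-- The group `t ↦ e^{-iAt}` for a bounded operator `A`. -/
noncomputable def expGroup (A : K →L[ℂ] K) (t : ℝ) : K →L[ℂ] K :=
  NormedSpace.exp (t • (-Complex.I • A))

theorem expGroup_zero (A : K →L[ℂ] K) : expGroup A 0 = 1 := by
  rw [expGroup, zero_smul, NormedSpace.exp_zero]

theorem expGroup_add_time (A : K →L[ℂ] K) (s t : ℝ) :
    expGroup A (s + t) = expGroup A s * expGroup A t := by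
  let _ : NormedAlgebra ℚ (K →L[ℂ] K) := NormedAlgebra.restrictScalars ℚ ℂ _
  rw [expGroup, add_smul, NormedSpace.exp_add_of_commute]
  · rfl
  · exact ((Commute.refl _).smul_left _).smul_right _

theorem expGroup_add_of_commute {A B : K →L[ℂ] K} (h : Commute A B) (t : ℝ) :
    expGroup (A + B) t = expGroup A t * expGroup B t := by
  let _ : NormedAlgebra ℚ (K →L[ℂ] K) := NormedAlgebra.restrictScalars ℚ ℂ _
  rw [expGroup, smul_add, smul_add, NormedSpace.exp_add_of_commute]
  · rfl
  · exact (((h.smul_left _).smul_left _).smul_right _).smul_right _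

theorem norm_expGroup_apply {A : K →L[ℂ] K} (hA : IsSelfAdjoint A) (t : ℝ) (x : K) :
    ‖expGroup A t x‖ = ‖x‖ := by
  let _ : NormedAlgebra ℚ (K →L[ℂ] K) := NormedAlgebra.restrictScalars ℚ ℂ _
  have hmem : expGroup A t ∈ unitary (K →L[ℂ] K) := by
    refine NormedSpace.exp_mem_unitary_of_mem_skewAdjoint ?_
    rw [skewAdjoint.mem_iff, star_smul, star_smul, hA.star_eq]
    simp
  exact ContinuousLinearMap.norm_map_of_mem_unitary hmem x

theorem hasDerivAt_expGroup_apply (A : K →L[ℂ] K) (t : ℝ) (x : K) :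
    HasDerivAt (fun s => expGroup A s x) (-Complex.I • expGroup A t (A x)) t := by
  have h1 := hasDerivAt_exp_smul_const (𝕂 := ℝ) (-Complex.I • A) t
  have h2 := (((ContinuousLinearMap.apply ℂ K x).restrictScalars ℝ).hasFDerivAt).comp_hasDerivAt t h1
  refine h2.congr_deriv ?_
  change expGroup A t ((-Complex.I • A) x) = _
  rw [smul_apply, map_smul]

theorem norm_expGroup_apply_sub_le {A : K →L[ℂ] K} (hA : IsSelfAdjoint A) (t : ℝ) (x : K) :
    ‖expGroup A t x - x‖ ≤ ‖A x‖ * |t| := by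
  have h := convex_univ.norm_image_sub_le_of_norm_hasDerivWithin_le (C := ‖A x‖)
    (fun s _ => (hasDerivAt_expGroup_apply A s x).hasDerivWithinAt)
    (fun s _ => by rw [norm_smul, norm_expGroup_apply hA]; simp)
    (Set.mem_univ 0) (Set.mem_univ t)
  simpa [expGroup_zero] using h

/-- Mean value inequality on `[-|t|, |t|]`: the derivative of `exp(-isA)x + isAx` is `-i(exp(-isA)Ax
- Ax)`. It controls the first-order remainder at `0` without reference to `‖A‖`, so that it survives
the Yosida limit. -/
theorem norm_expGroup_apply_sub_add_smul_le (A : K →L[ℂ] K) {t C : ℝ} {x : K}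
    (h : ∀ s, |s| ≤ |t| → ‖expGroup A s (A x) - A x‖ ≤ C) :
    ‖expGroup A t x - x + t • Complex.I • A x‖ ≤ C * |t| := by
  have hd : ∀ s, HasDerivAt (fun s : ℝ => expGroup A s x + s • Complex.I • A x)
      (-Complex.I • (expGroup A s (A x) - A x)) s := fun s =>
    ((hasDerivAt_expGroup_apply A s x).add ((hasDerivAt_id s).smul_const _)).congr_deriv
      (by simp only [one_smul]; module)
  have h1 := (convex_closedBall (0 : ℝ) |t|).norm_image_sub_le_of_norm_hasDerivWithin_le (C := C)
    (fun s _ => (hd s).hasDerivWithinAt)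
    (fun s hs => by
      rw [norm_smul, norm_neg, Complex.norm_I, one_mul]
      exact h s (by simpa using hs))
    (Metric.mem_closedBall_self (abs_nonneg t)) (show t ∈ _ by simp)
  simpa [expGroup_zero, add_sub_right_comm] using h1

/-- Commutation allows factoring the isometry `expGroup A t` out of the difference, which leaves
`expGroup (B - A) t x - x`. -/
theorem norm_expGroup_sub_expGroup_apply_le {A B : K →L[ℂ] K} (hA : IsSelfAdjoint A)
    (hB : IsSelfAdjoint B) (hAB : Commute A B) (t : ℝ) (x : K) :
    ‖expGroup A t x - expGroup B t x‖ ≤ ‖A x - B x‖ * |t| := by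
  have h1 := expGroup_add_of_commute (hAB.sub_right (Commute.refl A)) t
  rw [add_sub_cancel] at h1
  rw [h1, mul_apply_eq_comp, ← map_sub, norm_expGroup_apply hA, norm_sub_rev,
    norm_sub_rev (A x)]
  exact norm_expGroup_apply_sub_le (hB.sub hA) t x

end BoundedUnitaryGroup

/-! ### Stone's theorem -/

section Stone

open Filter Topology

variable {K : Type*} [NormedAddCommGroup K] [InnerProductSpace ℂ K] [CompleteSpace K]
  {H : K →ₗ.[ℂ] K}

/-- Sufficient conditions for a family of unitary operators to be the unitary group generated by a
self-adjoint operator. -/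
theorem IsUnitaryGroupOf.of_hasDerivAt (hH : IsSelfAdjoint H) {U : ℝ → K ≃ₗᵢ[ℂ] K}
    (h0 : ∀ x, U 0 x = x) (hadd : ∀ s t x, U (s + t) x = U s (U t x))
    (hd : ∀ x y, (x, y) ∈ H.graph → HasDerivAt (fun t => U t x) (-Complex.I • y) 0) :
    IsUnitaryGroupOf H U := by
  refine ⟨h0, hadd, fun x => ?_, fun x y => ⟨fun h => ?_, hd x y⟩⟩
  -- Continuity at `0` comes from differentiability on the dense domain, and the group law
  -- transports it to every time `s`.
  · have h1 : Tendsto (fun t => U t x) (𝓝 0) (𝓝 x) := by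
      refine tendsto_of_dense_of_contraction (T := fun t => U t) (fun t v w => ?_)
        hH.dense_domain (fun v hv => ?_) x
      · rw [← map_sub, LinearIsometryEquiv.norm_map]
      · have h2 := (hd v _ (LinearPMap.mem_graph H ⟨v, hv⟩)).continuousAt.tendsto
        rwa [h0] at h2
    refine continuous_iff_continuousAt.2 fun s => ?_
    have h2 : Tendsto (fun t : ℝ => t - s) (𝓝 s) (𝓝 0) :=
      (continuous_sub_right s).tendsto' s 0 (sub_self s)
    have h3 := ((U s).continuous.tendsto x).comp (h1.comp h2)
    refine h3.congr fun t => ?_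
    simp only [Function.comp]
    rw [← hadd, add_sub_cancel]
  -- The generator is no larger than `H`: differentiating `⟪U t x, x'⟫ = ⟪x, U (-t) x'⟫` at `0`, for
  -- `x'` in the domain, places `(x, y)` in the graph of the adjoint.
  · refine hH.mem_graph_of_inner_eq fun x' y' h' => ?_
    have h1 : HasDerivAt (fun t => ⟪U t x, x'⟫_ℂ) ⟪-Complex.I • y, x'⟫_ℂ 0 := by
      simpa using h.inner ℂ (hasDerivAt_const 0 x')
    have h2 : HasDerivAt (fun t => U (-t) x') (Complex.I • y') 0 := by
      have h3 : HasDerivAt (fun t => U t x') (-Complex.I • y') (-0) := by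
        rw [neg_zero]; exact hd x' y' h'
      exact (h3.scomp (0 : ℝ) (hasDerivAt_neg 0)).congr_deriv (by simp)
    have h3 : HasDerivAt (fun t => ⟪x, U (-t) x'⟫_ℂ) ⟪x, Complex.I • y'⟫_ℂ 0 := by
      simpa only [inner_zero_left, add_zero] using (hasDerivAt_const 0 x).inner ℂ h2
    have h4 : (fun t => ⟪U t x, x'⟫_ℂ) = fun t => ⟪x, U (-t) x'⟫_ℂ := by
      funext t
      rw [← (U t).inner_map_map x (U (-t) x'), ← hadd, add_neg_cancel, h0]
    rw [h4] at h1
    have h5 := h1.unique h3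
    rw [inner_smul_left, inner_smul_right, map_neg, Complex.conj_I, neg_neg] at h5
    exact mul_left_cancel₀ Complex.I_ne_zero h5

/-- **Stone's theorem**: a self-adjoint operator generates a strongly continuous unitary group. -/
theorem IsSelfAdjoint.exists_isUnitaryGroupOf (hH : IsSelfAdjoint H) :
    ∃ U, IsUnitaryGroupOf H U := by
  obtain ⟨A, hA, hcomm, hlim⟩ := hH.exists_bounded_approximation
  have hconv : ∀ t x, ∃ l, Tendsto (fun n => expGroup (A n) t x) atTop (𝓝 l) := by
    intro t x
    -- An `ε / 3` argument: `x` is replaced by `x'` in the domain at the cost of `dist x x'` twice,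
    -- and on `x'` the groups differ by at most `|t| * ‖A m x' - A n x'‖`. The `+ 1` in the
    -- denominator covers `t = 0`.
    refine cauchySeq_tendsto_of_complete (Metric.cauchySeq_iff.2 fun ε hε => ?_)
    obtain ⟨x', hx', hxx'⟩ := hH.dense_domain.exists_dist_lt x (show 0 < ε / 3 by positivity)
    obtain ⟨N, hN⟩ := Metric.cauchySeq_iff.1
      ((hlim x' _ (LinearPMap.mem_graph H ⟨x', hx'⟩)).1.cauchySeq) (ε / (3 * (|t| + 1)))
      (by positivity)
    refine ⟨N, fun m hm n hn => ?_⟩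
    have h1 := hN m hm n hn
    rw [lt_div_iff₀ (by positivity)] at h1
    have h2 := norm_expGroup_sub_expGroup_apply_le (hA m) (hA n) (hcomm m n) t x'
    have h3 : ∀ k, dist (expGroup (A k) t x) (expGroup (A k) t x') = dist x x' := fun k => by
      rw [dist_eq_norm, ← map_sub, norm_expGroup_apply (hA k), dist_eq_norm]
    have h4 := dist_triangle4 (expGroup (A m) t x) (expGroup (A m) t x') (expGroup (A n) t x')
      (expGroup (A n) t x)
    rw [h3, dist_comm (expGroup (A n) t x') (expGroup (A n) t x), h3] at h4
    rw [← dist_eq_norm, ← dist_eq_norm] at h2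
    nlinarith [dist_nonneg (x := A m x') (y := A n x')]
  choose U hU using hconv
  have hnorm : ∀ t x, ‖U t x‖ = ‖x‖ := fun t x => by
    refine tendsto_nhds_unique (hU t x).norm ?_
    simp only [norm_expGroup_apply (hA _)]
    exact tendsto_const_nhds
  have hzero : ∀ x, U 0 x = x := fun x => by
    refine tendsto_nhds_unique (hU 0 x) ?_
    simp only [expGroup_zero]
    exact tendsto_const_nhds
  have hadd : ∀ s t x, U (s + t) x = U s (U t x) := by
    intro s t x
    refine tendsto_nhds_unique (hU (s + t) x) ?_
    -- The approximating groups are isometric, so the inner limit may be taken under the outer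
    -- operator even though that operator varies with `n`.
    have h1 : Tendsto (fun n => expGroup (A n) s (expGroup (A n) t x - U t x)) atTop (𝓝 0) := by
      rw [tendsto_zero_iff_norm_tendsto_zero]
      simp only [norm_expGroup_apply (hA _)]
      exact tendsto_iff_norm_sub_tendsto_zero.1 (hU t x)
    have h2 := h1.add (hU s (U t x))
    rw [zero_add] at h2
    refine h2.congr fun n => ?_
    rw [map_sub, sub_add_cancel, expGroup_add_time]
    rfl
  let U' : ℝ → K ≃ₗᵢ[ℂ] K := fun t =>
    { toFun := U t
      invFun := U (-t)
      left_inv := fun x => by rw [← hadd, neg_add_cancel, hzero]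
      right_inv := fun x => by rw [← hadd, add_neg_cancel, hzero]
      map_add' := fun x y => tendsto_nhds_unique (hU t (x + y))
        (((hU t x).add (hU t y)).congr fun n => (map_add _ _ _).symm)
      map_smul' := fun c x => tendsto_nhds_unique (hU t (c • x))
        (((hU t x).const_smul c).congr fun n => (map_smul _ _ _).symm)
      norm_map' := hnorm t }
  refine ⟨U', IsUnitaryGroupOf.of_hasDerivAt hH hzero hadd fun x y hxy => ?_⟩
  rw [hasDerivAt_iff_isLittleO, Asymptotics.isLittleO_iff]
  intro ε hε
  -- The vector `y = H x` need not lie in the domain, so no second-order estimate applies to `x`. A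
  -- nearby `y'` in the domain replaces it; the error enters twice in `hbound`, whence `ε / 4`.
  obtain ⟨y', hy', hyy'⟩ := hH.dense_domain.exists_dist_lt y (show 0 < ε / 4 by positivity)
  rw [dist_eq_norm] at hyy'
  set z := H ⟨y', hy'⟩
  have hg : (y', z) ∈ H.graph := LinearPMap.mem_graph H ⟨y', hy'⟩
  have hbound : ∀ t, ‖U t x - x + t • Complex.I • y‖ ≤ (2 * ‖y - y'‖ + ‖z‖ * |t|) * |t| := by
    intro t
    have h1 : ∀ n, ‖expGroup (A n) t x - x + t • Complex.I • A n x‖ ≤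
        (2 * ‖A n x - y'‖ + ‖z‖ * |t|) * |t| := fun n => by
      refine norm_expGroup_apply_sub_add_smul_le (A n) fun s hs => ?_
      -- The two outer terms have norm `‖A n x - y'‖` each; the middle one is at most `‖A n y'‖ *
      -- |s| ≤ ‖z‖ * |t|`, uniformly in `n`.
      have e : expGroup (A n) s (A n x) - A n x = expGroup (A n) s (A n x - y') +
          (expGroup (A n) s y' - y') - (A n x - y') := by
        rw [map_sub]; abel
      rw [e]
      have h2 := norm_expGroup_apply_sub_le (hA n) s y'
      have h3 := (hlim y' z hg).2 n
      have h4 : ‖A n y'‖ * |s| ≤ ‖z‖ * |t| := by gcongr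
      have h5 := norm_expGroup_apply (hA n) s (A n x - y')
      refine (norm_sub_le _ _).trans ((add_le_add_left (norm_add_le _ _) _).trans ?_)
      linarith
    have h2 := (hlim x y hxy).1
    refine le_of_tendsto_of_tendsto' (((hU t x).sub_const x).add
      ((h2.const_smul Complex.I).const_smul t)).norm ?_ h1
    exact ((((h2.sub_const y').norm.const_mul 2).add_const _).mul_const _)
  have hsmall : ∀ᶠ t : ℝ in 𝓝 0, ‖z‖ * |t| < ε / 2 := by
    have : Tendsto (fun t : ℝ => ‖z‖ * |t|) (𝓝 0) (𝓝 0) :=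
      (continuous_const.mul continuous_abs).tendsto' _ _ (by simp)
    exact this.eventually_lt_const (by positivity)
  filter_upwards [hsmall] with t ht
  have h1 := hbound t
  have e : U' t x - U' 0 x - (t - 0) • (-Complex.I • y) = U t x - x + t • Complex.I • y := by
    change U t x - U 0 x - _ = _
    rw [hzero, sub_zero, neg_smul, smul_neg, sub_neg_eq_add]
  rw [e, sub_zero, Real.norm_eq_abs]
  refine h1.trans ?_
  gcongr
  linarith

theorem IsSelfAdjoint.isUnitaryGroupOf_unitaryGroup (hH : IsSelfAdjoint H) :
    IsUnitaryGroupOf H (unitaryGroup H) := by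
  have h := hH.exists_isUnitaryGroupOf
  rw [unitaryGroup, dif_pos h]
  exact h.choose_spec

end Stone

/-! ### Trace-norm estimates and continuity of the evolution -/

section TraceNormEstimates

open scoped InnerProduct
open Filter Topology

variable {K : Type*} [NormedAddCommGroup K] [InnerProductSpace ℂ K] [CompleteSpace K]

theorem Orthonormal.sum_norm_inner_mul_norm_inner_le {E ι : Type*} [NormedAddCommGroup E]
    [InnerProductSpace ℂ E] {e : ι → E} (he : Orthonormal ℂ e) (x y : E) (s : Finset ι) :
    ∑ k ∈ s, ‖⟪e k, x⟫_ℂ‖ * ‖⟪e k, y⟫_ℂ‖ ≤ ‖x‖ * ‖y‖ := by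
  refine le_of_sq_le_sq ?_ (by positivity)
  refine (Finset.sum_mul_sq_le_sq_mul_sq _ _ _).trans ?_
  rw [mul_pow]
  exact mul_le_mul (he.sum_inner_products_le x) (he.sum_inner_products_le y) (by positivity)
    (by positivity)

/-- Writing the absolute value as `W` times the operator, with `W` a contraction, bounds each
diagonal entry by `‖⟪eₖ, W x⟫‖ * ‖⟪eₖ, y⟫‖`; Cauchy-Schwarz and Bessel sum these. -/
theorem traceNorm_rankOne_le (x y : K) :
    traceNorm (InnerProductSpace.rankOne ℂ x y) ≤ ENNReal.ofReal (‖x‖ * ‖y‖) := by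
  obtain ⟨W, hW, h⟩ := exists_contraction_abs (InnerProductSpace.rankOne ℂ x y)
  rw [traceNorm, posTrace, tsum_congr fun k => ofReal_inner_abs h _, ENNReal.tsum_eq_iSup_sum]
  refine iSup_le fun s => ?_
  simp only [← ofReal_norm]
  rw [← ENNReal.ofReal_sum_of_nonneg fun _ _ => norm_nonneg _]
  refine ENNReal.ofReal_le_ofReal ?_
  have h1 := (onb K).orthonormal.sum_norm_inner_mul_norm_inner_le (W x) y s
  refine (Finset.sum_congr rfl fun k _ => ?_).trans_le (h1.trans ?_)
  · rw [InnerProductSpace.rankOne_apply, map_smul, inner_smul_right, norm_mul, mul_comm,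
      norm_inner_symm y]
  · gcongr
    exact (W.le_opNorm x).trans (mul_le_of_le_one_left (norm_nonneg _) hW)

namespace TraceClass

/-- The operator `z ↦ ⟪y, z⟫ x` of rank one, as a trace-class operator. -/
noncomputable def rankOne (x y : K) : TraceClass K :=
  ⟨InnerProductSpace.rankOne ℂ x y, (traceNorm_rankOne_le x y).trans_lt ENNReal.ofReal_lt_top⟩

theorem toCLM_rankOne (x y : K) : (rankOne x y).toCLM = InnerProductSpace.rankOne ℂ x y := rfl

theorem norm_rankOne_le (x y : K) : ‖rankOne x y‖ ≤ ‖x‖ * ‖y‖ :=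
  ENNReal.toReal_le_of_le_ofReal (by positivity) (traceNorm_rankOne_le x y)

theorem continuous_rankOne_self : Continuous fun x : K => rankOne x x := by
  refine continuous_iff_continuousAt.2 fun x₀ => tendsto_iff_norm_sub_tendsto_zero.2 ?_
  have hc : Tendsto (fun x : K => ‖x - x₀‖ * ‖x‖ + ‖x₀‖ * ‖x - x₀‖) (𝓝 x₀) (𝓝 0) := by
    refine Continuous.tendsto' (by fun_prop) _ _ (by simp)
  refine squeeze_zero (fun _ => norm_nonneg _) (fun x => ?_) hc
  have e : rankOne x x - rankOne x₀ x₀ = rankOne (x - x₀) x + rankOne x₀ (x - x₀) := by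
    ext z
    simp [toCLM_rankOne]
  rw [e]
  exact (norm_add_le _ _).trans (add_le_add (norm_rankOne_le _ _) (norm_rankOne_le _ _))

theorem norm_sandwich_le {L : Type*} [NormedAddCommGroup L] [InnerProductSpace ℂ L]
    [CompleteSpace L] (B : K →L[ℂ] L) (A : TraceClass K) (C : L →L[ℂ] K) :
    ‖sandwich B A C‖ ≤ ‖B‖ * ‖C‖ * ‖A‖ := by
  have h := ENNReal.toReal_mono (ENNReal.mul_lt_top (ENNReal.mul_lt_top enorm_lt_top enorm_lt_top)
    A.traceNorm_lt_top).ne (traceNorm_comp_le A.toCLM B C)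
  rwa [ENNReal.toReal_mul, ENNReal.toReal_mul, toReal_enorm, toReal_enorm] at h

/-- The square root of a positive trace-class operator is a Hilbert-Schmidt operator. -/
theorem hasSum_norm_sqrt_sq {A : TraceClass K} (hA : A.toCLM.IsPositive) :
    HasSum (fun k => ‖CFC.sqrt A.toCLM (onb K k)‖ ^ 2) A.trace.re := by
  have h0 : 0 ≤ A.toCLM := (ContinuousLinearMap.nonneg_iff_isPositive _).2 hA
  have hS : (CFC.sqrt A.toCLM)† = CFC.sqrt A.toCLM := (CFC.sqrt_nonneg A.toCLM).isSelfAdjoint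
  have hSS : CFC.sqrt A.toCLM ∘L CFC.sqrt A.toCLM = A.toCLM := CFC.sqrt_mul_sqrt_self _ h0
  convert Complex.hasSum_re (A.hasSum_trace (onb K)) using 2 with k
  conv_rhs => rw [← hSS]
  rw [ContinuousLinearMap.comp_apply, ← ContinuousLinearMap.adjoint_inner_left, hS]
  exact norm_sq_eq_re_inner (𝕜 := ℂ) _

/-- A positive operator is its own absolute value, so trace norm and trace are the same series. This
gives density operators norm one. -/
theorem norm_eq_re_trace {A : TraceClass K} (hA : A.toCLM.IsPositive) : ‖A‖ = A.trace.re := by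
  have h0 : 0 ≤ A.toCLM := (ContinuousLinearMap.nonneg_iff_isPositive _).2 hA
  have h1 := Complex.hasSum_re (A.hasSum_trace (onb K))
  have hnn : ∀ k, 0 ≤ (⟪onb K k, A.toCLM (onb K k)⟫_ℂ).re := fun k =>
    (Complex.nonneg_iff.1 (hA.inner_nonneg_right _)).1
  rw [norm_def, traceNorm, CFC.abs_of_nonneg _ h0, posTrace]
  change (∑' k, ENNReal.ofReal (⟪onb K k, A.toCLM (onb K k)⟫_ℂ).re).toReal = _
  rw [← ENNReal.ofReal_tsum_of_nonneg hnn h1.summable, h1.tsum_eq,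
    ENNReal.toReal_ofReal (h1.nonneg hnn)]

end TraceClass

theorem IsDensityOperator.norm_eq_one {ρ : TraceClass K} (hρ : IsDensityOperator ρ) : ‖ρ‖ = 1 := by
  rw [TraceClass.norm_eq_re_trace hρ.isPositive, hρ.trace_eq_one, Complex.one_re]

theorem norm_evolve_le (H : K →ₗ.[ℂ] K) (ρ : TraceClass K) (t : ℝ) : ‖evolve H ρ t‖ ≤ ‖ρ‖ := by
  have h : ∀ U : K ≃ₗᵢ[ℂ] K, ‖(U : K →L[ℂ] K)‖ ≤ 1 := fun U =>
    ContinuousLinearMap.opNorm_le_bound _ zero_le_one fun x => by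
      rw [one_mul]; exact (U.norm_map x).le
  refine (TraceClass.norm_sandwich_le _ _ _).trans ?_
  exact mul_le_of_le_one_left (norm_nonneg _) (mul_le_one₀ (h _) (norm_nonneg _) (h _))

/-- The evolution of a positive trace-class operator is continuous in trace norm. -/
theorem continuous_evolve {H : K →ₗ.[ℂ] K} (hH : IsUnitaryGroupOf H (unitaryGroup H))
    {ρ : TraceClass K} (hρ : ρ.toCLM.IsPositive) : Continuous (evolve H ρ) := by
  set U := unitaryGroup H
  set S := CFC.sqrt ρ.toCLM
  have hS : S† = S := (CFC.sqrt_nonneg ρ.toCLM).isSelfAdjoint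
  have hSS : S ∘L S = ρ.toCLM :=
    CFC.sqrt_mul_sqrt_self _ ((ContinuousLinearMap.nonneg_iff_isPositive _).2 hρ)
  have hsum : Summable fun k => ‖S (onb K k)‖ ^ 2 := (TraceClass.hasSum_norm_sqrt_sq hρ).summable
  let v : onbSet K → ℝ → K := fun k t => U t (S (onb K k))
  have hle : ∀ k t, ‖TraceClass.rankOne (v k t) (v k t)‖ ≤ ‖S (onb K k)‖ ^ 2 := fun k t => by
    refine (TraceClass.norm_rankOne_le _ _).trans_eq ?_
    rw [(U t).norm_map, sq]
  have hadj : ∀ t x y, ⟪U t x, y⟫_ℂ = ⟪x, U (-t) y⟫_ℂ := fun t x y => by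
    rw [← (U t).inner_map_map x (U (-t) y), ← hH.map_add, add_neg_cancel, hH.map_zero]
  have hadj' : ∀ t x y, ⟪x, U t y⟫_ℂ = ⟪U (-t) x, y⟫_ℂ := fun t x y => by
    rw [← inner_conj_symm, hadj, inner_conj_symm]
  have hsym : ∀ x y, ⟪S x, y⟫_ℂ = ⟪x, S y⟫_ℂ := fun x y => by
    rw [← ContinuousLinearMap.adjoint_inner_right, hS]
  -- The resolution of the identity is inserted between the two factors of `ρ = S S`. No eigenbasis
  -- of `ρ` is needed.
  have heq : evolve H ρ = fun t => ∑' k, TraceClass.rankOne (v k t) (v k t) := by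
    funext t
    have hs : Summable fun k => TraceClass.rankOne (v k t) (v k t) :=
      Summable.of_norm_bounded hsum fun k => hle k t
    ext y
    -- Equality is tested on matrix elements, where the series is the Parseval expansion of `⟪S (U
    -- (-t) x), S (U (-t) y)⟫`.
    refine ext_inner_left ℂ fun x => ?_
    refine HasSum.unique ?_ (TraceClass.hasSum_inner hs.hasSum x y)
    have h1 := (onb K).hasSum_inner_mul_inner (S (U (-t) x)) (S (U (-t) y))
    have e1 : ⟪S (U (-t) x), S (U (-t) y)⟫_ℂ = ⟪x, (evolve H ρ t).toCLM y⟫_ℂ := by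
      have e : (evolve H ρ t).toCLM y = U t (S (S (U (-t) y))) :=
        congrArg (fun T : K →L[ℂ] K => U t (T (U (-t) y))) hSS.symm
      rw [e, hadj', hsym]
    have e2 : ∀ k, ⟪S (U (-t) x), onb K k⟫_ℂ * ⟪onb K k, S (U (-t) y)⟫_ℂ =
        ⟪x, (TraceClass.rankOne (v k t) (v k t)).toCLM y⟫_ℂ := fun k => by
      rw [TraceClass.toCLM_rankOne, InnerProductSpace.rankOne_apply, inner_smul_right, hadj t,
        hadj' t x, hsym, hsym (onb K k), mul_comm]
    simp only [e1, e2] at h1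
    exact h1
  rw [heq]
  exact continuous_tsum (fun k => TraceClass.continuous_rankOne_self.comp (hH.continuous _)) hsum hle

end TraceNormEstimates

/-! ### The partial trace as a trace-norm contraction -/

section PartialTraceBounds

variable {Hs Hb : Type*}
  [NormedAddCommGroup Hs] [InnerProductSpace ℂ Hs] [CompleteSpace Hs]
  [NormedAddCommGroup Hb] [InnerProductSpace ℂ Hb] [CompleteSpace Hb]

theorem norm_partialTrace_le (T : TraceClass (HilbertTensor Hs Hb)) :
    ‖partialTrace T‖ ≤ ‖T‖ := by
  have h := sum_norm_diagBlock_le (onb Hb).orthonormal T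
  have hs := summable_of_sum_le (fun _ => norm_nonneg _) h
  exact (norm_tsum_le_tsum_norm hs).trans (hs.tsum_le_of_sum_le h)

theorem partialTrace_sub (T T' : TraceClass (HilbertTensor Hs Hb)) :
    partialTrace (T - T') = partialTrace T - partialTrace T' := by
  rw [partialTrace, partialTrace, partialTrace, ← (summable_diagBlock (onb Hb).orthonormal T).tsum_sub
    (summable_diagBlock (onb Hb).orthonormal T')]
  refine tsum_congr fun j => ?_
  ext x
  simp [diagBlock]

theorem continuous_partialTrace :
    Continuous (partialTrace : TraceClass (HilbertTensor Hs Hb) → TraceClass Hs) := by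
  refine (LipschitzWith.of_dist_le_mul (K := 1) fun T T' => ?_).continuous
  rw [dist_eq_norm, dist_eq_norm, ← partialTrace_sub, NNReal.coe_one, one_mul]
  exact norm_partialTrace_le _

end PartialTraceBounds

/-! ### Laplace transforms of bounded continuous vector-valued functions -/

section LaplaceTransform

open MeasureTheory Set Filter Topology

variable {E : Type*} [NormedAddCommGroup E] [NormedSpace ℂ E]

theorem norm_exp_I_mul_mul_ofReal (z : ℂ) (t : ℝ) :
    ‖Complex.exp (Complex.I * z * t)‖ = Real.exp (-z.im * t) := by
  rw [Complex.norm_exp]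
  simp

variable {f : ℝ → E} {C : ℝ}

theorem norm_exp_smul_le (hC : ∀ t, ‖f t‖ ≤ C) (z : ℂ) (t : ℝ) :
    ‖Complex.exp (Complex.I * z * t) • f t‖ ≤ C * Real.exp (-z.im * t) := by
  rw [norm_smul, norm_exp_I_mul_mul_ofReal, mul_comm]
  gcongr
  exact hC t

theorem continuous_exp_smul (hf : Continuous f) (z : ℂ) :
    Continuous fun t : ℝ => Complex.exp (Complex.I * z * t) • f t := by
  fun_prop

theorem integrableOn_exp_smul (hf : Continuous f) (hC : ∀ t, ‖f t‖ ≤ C) {z : ℂ} (hz : 0 < z.im) :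
    IntegrableOn (fun t : ℝ => Complex.exp (Complex.I * z * t) • f t) (Ioi 0) :=
  ((exp_neg_integrableOn_Ioi 0 hz).const_mul C).mono'
    (continuous_exp_smul hf z).aestronglyMeasurable (Eventually.of_forall (norm_exp_smul_le hC z))

theorem norm_integral_exp_smul_le (hC : ∀ t, ‖f t‖ ≤ C) {z : ℂ} (hz : 0 < z.im) :
    ‖∫ t in Ioi (0 : ℝ), Complex.exp (Complex.I * z * t) • f t‖ ≤ C / z.im := by
  refine (norm_integral_le_of_norm_le ((exp_neg_integrableOn_Ioi 0 hz).const_mul C)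
    (Eventually.of_forall (norm_exp_smul_le hC z))).trans_eq ?_
  rw [integral_const_mul, integral_exp_mul_Ioi (neg_lt_zero.2 hz)]
  simp [div_eq_mul_inv]

/-- Differentiation under the integral sign: near a given point the `z`-derivative of the integrand
has an integrable bound independent of `z`. -/
theorem differentiableOn_integral_exp_smul (hf : Continuous f) (hC : ∀ t, ‖f t‖ ≤ C) :
    DifferentiableOn ℂ (fun z => ∫ t in Ioi (0 : ℝ), Complex.exp (Complex.I * z * t) • f t)
      {z : ℂ | 0 < z.im} := by
  intro z₀ hz₀
  have hz₀' : 0 < z₀.im := hz₀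
  have hC0 : 0 ≤ C := (norm_nonneg _).trans (hC 0)
  -- Half of `Im z₀` keeps a whole neighbourhood of `z₀` above height `δ`, where `C * t * exp(-δt)`
  -- dominates the derivative.
  set δ := z₀.im / 2 with hδ
  have hδpos : 0 < δ := half_pos hz₀'
  have hs : {z : ℂ | δ < z.im} ∈ 𝓝 z₀ :=
    (isOpen_lt continuous_const Complex.continuous_im).mem_nhds (half_lt_self hz₀')
  have hint : IntegrableOn (fun t : ℝ => C * (t * Real.exp (-δ * t))) (Ioi 0) := by
    have h := integrableOn_rpow_mul_exp_neg_mul_rpow (s := 1) (p := 1) (by norm_num) one_pos hδpos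
    simp only [Real.rpow_one] at h
    exact h.const_mul C
  have h := hasDerivAt_integral_of_dominated_loc_of_deriv_le (𝕜 := ℂ)
    (μ := volume.restrict (Ioi (0 : ℝ)))
    (F := fun z t => Complex.exp (Complex.I * z * t) • f t)
    (F' := fun z t => (Complex.exp (Complex.I * z * t) * (Complex.I * t)) • f t)
    (bound := fun t => C * (t * Real.exp (-δ * t))) hs
    (Eventually.of_forall fun z => (continuous_exp_smul hf z).aestronglyMeasurable)
    (integrableOn_exp_smul hf hC hz₀')
    (Continuous.aestronglyMeasurable (by fun_prop)) ?_ hint ?_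
  · exact h.2.differentiableAt.differentiableWithinAt
  · refine (ae_restrict_iff' measurableSet_Ioi).2 (Eventually.of_forall fun t ht z hz => ?_)
    have ht' : 0 < t := ht
    have hz' : δ < z.im := hz
    rw [norm_smul, norm_mul, norm_exp_I_mul_mul_ofReal, norm_mul, Complex.norm_I, one_mul,
      Complex.norm_real, Real.norm_of_nonneg ht'.le]
    have h1 : Real.exp (-z.im * t) ≤ Real.exp (-δ * t) := by gcongr
    calc Real.exp (-z.im * t) * t * ‖f t‖ ≤ Real.exp (-δ * t) * t * C := by
          gcongr
          exact hC t
      _ = C * (t * Real.exp (-δ * t)) := by ring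
  · refine Eventually.of_forall fun t z _ => ?_
    have h1 : HasDerivAt (fun z : ℂ => Complex.I * z * t) (Complex.I * t) z := by
      simpa using ((hasDerivAt_id z).const_mul Complex.I).mul_const (t : ℂ)
    exact h1.cexp.smul_const (f t)

end LaplaceTransform

theorem theorem6 {Hs Hb : Type*}
    [NormedAddCommGroup Hs] [InnerProductSpace ℂ Hs] [CompleteSpace Hs]
    [NormedAddCommGroup Hb] [InnerProductSpace ℂ Hb] [CompleteSpace Hb]
    (H : HilbertTensor Hs Hb →ₗ.[ℂ] HilbertTensor Hs Hb) (hH : IsSelfAdjoint H)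
    (ρ₀ : TraceClass (HilbertTensor Hs Hb)) (hρ₀ : IsDensityOperator ρ₀) :
    -- `t ↦ e^{-iHt}` is the strongly continuous unitary group generated by `-iH`
    IsUnitaryGroupOf H (unitaryGroup H) ∧
    -- trace-norm continuity of the evolution, of the partial trace, and of the reduced state
    Continuous (evolve H ρ₀) ∧
    Continuous (partialTrace : TraceClass (HilbertTensor Hs Hb) → TraceClass Hs) ∧
    Continuous (reducedState H ρ₀) ∧
    -- `‖σ(t)‖_op ≤ 1`
    (∀ t : ℝ, 0 ≤ t → ‖(reducedState H ρ₀ t).toCLM‖ ≤ 1) ∧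
    -- the Laplace integral converges in trace norm
    (∀ z : ℂ, 0 < z.im → MeasureTheory.IntegrableOn
      (fun t : ℝ => Complex.exp (Complex.I * z * t) • reducedState H ρ₀ t) (Set.Ioi 0)) ∧
    -- the Laplace transform is analytic as a trace-class-valued function
    AnalyticOnNhd ℂ (reducedStateLaplace H ρ₀) {z : ℂ | 0 < z.im} ∧
    -- `‖σ̃(z)‖_op ≤ 1 / Im z`
    (∀ z : ℂ, 0 < z.im → ‖(reducedStateLaplace H ρ₀ z).toCLM‖ ≤ 1 / z.im) := by
  have hU := hH.isUnitaryGroupOf_unitaryGroup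
  have hev : Continuous (evolve H ρ₀) := continuous_evolve hU hρ₀.isPositive
  have hσ : Continuous (reducedState H ρ₀) := continuous_partialTrace.comp hev
  -- The bound is kept in the stronger trace norm, which serves both the Bochner integral and the
  -- operator-norm estimates.
  have hle : ∀ t, ‖reducedState H ρ₀ t‖ ≤ 1 := fun t =>
    ((norm_partialTrace_le _).trans (norm_evolve_le H ρ₀ t)).trans_eq hρ₀.norm_eq_one
  refine ⟨hU, hev, continuous_partialTrace, hσ,
    fun t _ => (reducedState H ρ₀ t).norm_toCLM_le.trans (hle t),
    fun z hz => integrableOn_exp_smul hσ hle hz, ?_,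
    fun z hz => (TraceClass.norm_toCLM_le _).trans (norm_integral_exp_smul_le hle hz)⟩
  exact (differentiableOn_integral_exp_smul hσ hle).analyticOnNhd
    (isOpen_lt continuous_const Complex.continuous_im)
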